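/- Let $d\in\{2,3\}$ and let $\Omega\subset\mathbb R^d$ be a polygonal/polyhedral domain, i.e. a nonempty open set with $\Omega=\operatorname{int}\overline\Omega$ such that $\overline\Omega$ is the union of the simplices of a finite conforming triangulation. Let $n$ be the outward unit normal on $\partial\Omega$. Let $\Gamma_V,\Gamma_W\subset\partial\Omega$ be disjoint connected sets (possibly empty) with $\overline{\Gamma}_V\cup\overline{\Gamma}_W=\partial\Omega$, whose boundaries relative to $\partial\Omega$ have zero surface measure. Let $\kappa\in\mathbb R$ and put $$V=\{v\in H^1(\Omega): v|_{\Gamma_V}=0\},\qquad W=\{v\in H^1(\Omega): v|_{\Gamma_W}=0\},$$ $$a(v,w)=(\nabla v,\nabla w)+\kappa(v,w),\qquad \mathcal L v=\mathcal L^*v=-\Delta v+\kappa v,$$ where $(\cdot,\cdot)$ is the $L^2(\Omega)$ inner product and restrictions to the boundary are traces. Let $\mathcal T_h$ be a finite conforming triangulation of $\Omega$ into simplices, let $k\ge 0$ be an integer, let $$V_h=W_h=X_h^k:=\{v_h\in H^1(\Omega): v_h|_K\in\mathbb P_k(K)\ \text{ for all } K\in\mathcal T_h\},$$ and define $$a_h(v,w)=(\nabla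 v,\nabla w)+\kappa(v,w)-\langle\nabla w\cdot n,\,v\rangle_{\Gamma_V}-\langle\nabla v\cdot n,\,w\rangle_{\Gamma_W},$$ where $\langle\cdot,\cdot\rangle_\Gamma$ is the $L^2(\Gamma)$ inner product with respect to surface measure, and boundary values of functions and of their gradients are taken as traces from the elements of $\mathcal T_h$; a component of the gradient of a test function that has no such trace is given the boundary value $0$ (its normal derivative is only ever multiplied by a factor that vanishes almost everywhere). Then: 1. (Primal consistency.) Let $f\in L^2(\Omega)$ and let $u\in H^2(\Omega)$ be a solution of the primal Cauchy problem, either in the weak sense, $u\in V$ and $a(u,w)=(f,w)$ for all $w\in W$, or in the strong sense, $-\Delta u+\kappa u=f$ a.e. in $\Omega$ and $\nabla u\cdot n=u=0$ a.e. on $\Gamma_V$. Then $$a_h(u,\varphi)=(\mathcal L u,\varphi)\qquad\text{for all }\varphi\in W+W_h .$$ 2. (Adjoint consistency.) Let $g\in L^2(\Omega)$ and let $z\in H^2(\Omega)$ be a solution of the adjoint Cauchy problem, either in the weak sense, $z\in W$ and $a(v,z)=(g,v)$ for all $v\in V$, or in the strong sense, $-\Delta z+\kappa z=g$ a.e. in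 $\Omega$ and $\nabla z\cdot n=z=0$ a.e. on $\Gamma_W$. Then $$a_h(\phi,z)=(\phi,\mathcal L^* z)\qquad\text{for all }\phi\in V+V_h .$$ -/

import Mathlib

open MeasureTheory Filter Topology Set
open scoped ContDiff

noncomputable section

namespace CauchyFEM

/-- The ambient Euclidean space `ℝ^d`. -/
abbrev Euc (d : ℕ) : Type := EuclideanSpace ℝ (Fin d)

variable {d : ℕ}

/-- The surface measure: the `(d-1)`-dimensional Hausdorff measure, normalised so that it agrees
with Lebesgue measure on hyperplanes. -/
def surf (d : ℕ) : Measure (Euc d) := μHE[d - 1]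

/-- The classical partial derivative `∂_i ψ` of a differentiable function. -/
def partialDeriv (i : Fin d) (ψ : Euc d → ℝ) (x : Euc d) : ℝ :=
  fderiv ℝ ψ x (EuclideanSpace.single i (1 : ℝ))

/-! ### Sobolev spaces on an open set -/

/-- `v ∈ L²(D)`. -/
def MemL2 (D : Set (Euc d)) (v : Euc d → ℝ) : Prop :=
  MemLp v 2 (volume.restrict D)

/-- `g ∈ L²(D)` is the weak partial derivative `∂_i v` on `D`. -/
def IsWeakPartial (D : Set (Euc d)) (i : Fin d) (v g : Euc d → ℝ) : Prop :=
  MemL2 D g ∧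
    ∀ ψ : Euc d → ℝ, ContDiff ℝ ∞ ψ → HasCompactSupport ψ → tsupport ψ ⊆ D →
      ∫ x in D, v x * partialDeriv i ψ x = - ∫ x in D, g x * ψ x

/-- `v ∈ H¹(D)`. -/
def MemH1 (D : Set (Euc d)) (v : Euc d → ℝ) : Prop :=
  MemL2 D v ∧ ∀ i, ∃ g, IsWeakPartial D i v g

open Classical in
/-- The weak partial derivative `∂_i v ∈ L²(D)` (unique almost everywhere on `D`) of a function
that has one; the value is `0` for other functions. -/
def weakPartial (D : Set (Euc d)) (i : Fin d) (v : Euc d → ℝ) : Euc d → ℝ :=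
  if h : ∃ g, IsWeakPartial D i v g then h.choose else 0

/-- `v ∈ H²(D)`. -/
def MemH2 (D : Set (Euc d)) (v : Euc d → ℝ) : Prop :=
  MemH1 D v ∧ ∀ i, MemH1 D (weakPartial D i v)

/-- The weak Laplacian of a function of `H²(D)`. -/
def laplacian (D : Set (Euc d)) (v : Euc d → ℝ) (x : Euc d) : ℝ :=
  ∑ i, weakPartial D i (weakPartial D i v) x

/-- The inner product of `L²(D)`. -/
def innerL2 (D : Set (Euc d)) (v w : Euc d → ℝ) : ℝ :=
  ∫ x in D, v x * w x

/-- `(∇v, ∇w)_D`. -/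
def innerGrad (D : Set (Euc d)) (v w : Euc d → ℝ) : ℝ :=
  ∫ x in D, ∑ i, weakPartial D i v x * weakPartial D i w x

/-- `g ∈ L²(S)` is the trace on `S ⊆ ∂D` of `v ∈ H¹(D)`: some sequence of restrictions of smooth
functions converges to `v` in `H¹(D)` while its restrictions to `S` converge to `g` in `L²(S)`. -/
def HasTrace (D S : Set (Euc d)) (v g : Euc d → ℝ) : Prop :=
  MemH1 D v ∧ MemLp g 2 ((surf d).restrict S) ∧
    ∃ ψ : ℕ → Euc d → ℝ, (∀ n, ContDiff ℝ ∞ (ψ n)) ∧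
      Tendsto (fun n => eLpNorm (fun x => ψ n x - v x) 2 (volume.restrict D)) atTop (𝓝 0) ∧
      (∀ i, Tendsto (fun n => eLpNorm (fun x => partialDeriv i (ψ n) x - weakPartial D i v x) 2
        (volume.restrict D)) atTop (𝓝 0)) ∧
      Tendsto (fun n => eLpNorm (fun x => ψ n x - g x) 2 ((surf d).restrict S)) atTop (𝓝 0)

/-- The space `{v ∈ H¹(Ω) : v = 0 on Γ}` for `Γ ⊆ ∂Ω`, in the sense of traces. -/
def MemH1Zero (Ω Γ : Set (Euc d)) (v : Euc d → ℝ) : Prop :=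
  MemH1 Ω v ∧ ∃ g, HasTrace Ω (frontier Ω) v g ∧ ∀ᵐ x ∂((surf d).restrict Γ), g x = 0

/-! ### Polygonal / polyhedral domains, triangulations, finite elements -/

/-- A (conforming, finite) triangulation of the domain `Ω`. -/
structure Triangulation (Ω : Set (Euc d)) where
  /-- The underlying simplicial complex. -/
  complex : Geometry.SimplicialComplex ℝ (Euc d)
  finite : complex.faces.Finite
  /-- Every face belongs to a `d`-dimensional simplex. -/
  pure : ∀ s ∈ complex.faces, ∃ t ∈ complex.faces, s ⊆ t ∧ t.card = d + 1
  space_eq : complex.space = closure Ω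

/-- The elements of the triangulation, given by their vertex sets. -/
def Triangulation.elements {Ω : Set (Euc d)} (T : Triangulation Ω) : Set (Finset (Euc d)) :=
  {s | s ∈ T.complex.faces ∧ s.card = d + 1}

/-- A polygonal / polyhedral domain: a nonempty open set which is the interior of its closure and
whose closure is the union of the simplices of a finite triangulation. -/
def IsPolyhedralDomain (Ω : Set (Euc d)) : Prop :=
  Ω.Nonempty ∧ IsOpen Ω ∧ interior (closure Ω) = Ω ∧ Nonempty (Triangulation Ω)

/-- The finite element space `X_h^k = {v ∈ H¹(Ω) : v|_K ∈ ℙ_k(K) for all elements K}`. -/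
def MemFE {Ω : Set (Euc d)} (T : Triangulation Ω) (k : ℕ) (v : Euc d → ℝ) : Prop :=
  MemH1 Ω v ∧ ∀ s ∈ T.elements, ∃ p : MvPolynomial (Fin d) ℝ, p.totalDegree ≤ k ∧
    ∀ᵐ x ∂(volume.restrict (convexHull ℝ (s : Set (Euc d)))),
      v x = MvPolynomial.eval (fun j => x j) p

/-- `ν` is the outward unit normal to `Ω` at a boundary point `x` near which `Ω` is a half-space. -/
def IsOuterNormal (Ω : Set (Euc d)) (x ν : Euc d) : Prop :=
  ‖ν‖ = 1 ∧ ∃ ε > 0, ∀ y ∈ Metric.ball x ε, y ∈ Ω ↔ inner ℝ (y - x) ν < 0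

open Classical in
/-- The outward unit normal `n` on the flat parts of `∂Ω` (hence almost everywhere on the boundary
of a polyhedral domain), and `0` elsewhere. -/
def outerNormal (Ω : Set (Euc d)) (x : Euc d) : Euc d :=
  if h : ∃ ν, IsOuterNormal Ω x ν then h.choose else 0

/-- `g` is the elementwise trace on `∂Ω` of the piecewise `H¹` function `v`: on each face on `∂Ω`
of each element `K` (the face opposite to a vertex `p` of `K`), `g` is the trace of `v|_K`. -/
def IsBdryTrace {Ω : Set (Euc d)} (T : Triangulation Ω) (v g : Euc d → ℝ) : Prop :=
  ∀ s ∈ T.elements, ∀ p ∈ s,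
    convexHull ℝ ((s : Set (Euc d)) \ {p}) ⊆ frontier Ω →
      HasTrace (interior (convexHull ℝ (s : Set (Euc d))))
        (convexHull ℝ ((s : Set (Euc d)) \ {p})) v g

open Classical in
/-- The elementwise trace on `∂Ω` of a function that has one, and `0` for other functions. It exists
for every function that is `H¹` on each element, and is unique almost everywhere on `∂Ω`. -/
def bdryTrace {Ω : Set (Euc d)} (T : Triangulation Ω) (v : Euc d → ℝ) : Euc d → ℝ :=
  if h : ∃ g, IsBdryTrace T v g then h.choose else 0

/-- The normal derivative `∇v · n` on `∂Ω`, for `v ∈ H¹(Ω)` whose gradient is piecewise `H¹`. -/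
def normalDeriv {Ω : Set (Euc d)} (T : Triangulation Ω) (v : Euc d → ℝ) (x : Euc d) : ℝ :=
  ∑ i, bdryTrace T (weakPartial Ω i v) x * outerNormal Ω x i

/-! ### The Cauchy problem and its discrete bilinear form -/

/-- The splitting of `∂Ω` into two disjoint connected portions whose closures cover `∂Ω` and whose
boundaries relative to `∂Ω` are null sets of the surface measure. -/
structure IsBoundarySplitting (Ω ΓV ΓW : Set (Euc d)) : Prop where
  subset_V : ΓV ⊆ frontier Ω
  subset_W : ΓW ⊆ frontier Ω
  connected_V : IsPreconnected ΓV
  connected_W : IsPreconnected ΓW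
  disjoint : Disjoint ΓV ΓW
  cover : closure ΓV ∪ closure ΓW = frontier Ω
  null_V : surf d (closure ΓV ∩ closure (frontier Ω \ ΓV)) = 0
  null_W : surf d (closure ΓW ∩ closure (frontier Ω \ ΓW)) = 0

/-- The operator `ℒ v = -Δ v + κ v`. -/
def opL (Ω : Set (Euc d)) (κ : ℝ) (v : Euc d → ℝ) (x : Euc d) : ℝ :=
  - laplacian Ω v x + κ * v x

/-- The formal adjoint `ℒ* z = -Δ z + κ z`, given by the same expression. -/
def opLAdj (Ω : Set (Euc d)) (κ : ℝ) (z : Euc d → ℝ) (x : Euc d) : ℝ :=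
  - laplacian Ω z x + κ * z x

/-- `a(v,w) = (∇v,∇w) + κ (v,w)`. -/
def formA (Ω : Set (Euc d)) (κ : ℝ) (v w : Euc d → ℝ) : ℝ :=
  innerGrad Ω v w + κ * innerL2 Ω v w

/-- Weak solutions of the primal problem: `u ∈ V` and `a(u,w) = (f,w)` for all `w ∈ W`. -/
def IsWeakPrimal (Ω ΓV ΓW : Set (Euc d)) (κ : ℝ) (f u : Euc d → ℝ) : Prop :=
  MemH1Zero Ω ΓV u ∧ ∀ w, MemH1Zero Ω ΓW w → formA Ω κ u w = innerL2 Ω f w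

/-- Weak solutions of the adjoint problem: `z ∈ W` and `a(v,z) = (g,v)` for all `v ∈ V`. -/
def IsWeakAdjoint (Ω ΓV ΓW : Set (Euc d)) (κ : ℝ) (g z : Euc d → ℝ) : Prop :=
  MemH1Zero Ω ΓW z ∧ ∀ v, MemH1Zero Ω ΓV v → formA Ω κ v z = innerL2 Ω g v

/-- Strong solutions (among functions of `H²(Ω)`) of the primal problem: `-Δu + κu = f` in `Ω`,
`∇u·n = u = 0` on `Γ_V`. -/
def IsStrongPrimal {Ω : Set (Euc d)} (T : Triangulation Ω) (ΓV : Set (Euc d)) (κ : ℝ)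
    (f u : Euc d → ℝ) : Prop :=
  MemH1Zero Ω ΓV u ∧ (∀ᵐ x ∂(volume.restrict Ω), opL Ω κ u x = f x) ∧
    ∀ᵐ x ∂((surf d).restrict ΓV), normalDeriv T u x = 0

/-- Strong solutions (among functions of `H²(Ω)`) of the adjoint problem: `-Δz + κz = g` in `Ω`,
`∇z·n = z = 0` on `Γ_W`. -/
def IsStrongAdjoint {Ω : Set (Euc d)} (T : Triangulation Ω) (ΓW : Set (Euc d)) (κ : ℝ)
    (g z : Euc d → ℝ) : Prop :=
  MemH1Zero Ω ΓW z ∧ (∀ᵐ x ∂(volume.restrict Ω), opLAdj Ω κ z x = g x) ∧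
    ∀ᵐ x ∂((surf d).restrict ΓW), normalDeriv T z x = 0

/-- The bilinear form
`a_h(v,w) = (∇v,∇w) + κ (v,w) - ⟨∇w·n, v⟩_{Γ_V} - ⟨∇v·n, w⟩_{Γ_W}`. -/
def formAh {Ω : Set (Euc d)} (T : Triangulation Ω) (ΓV ΓW : Set (Euc d)) (κ : ℝ)
    (v w : Euc d → ℝ) : ℝ :=
  innerGrad Ω v w + κ * innerL2 Ω v w
    - (∫ x in ΓV, normalDeriv T w x * bdryTrace T v x ∂(surf d))
    - ∫ x in ΓW, normalDeriv T v x * bdryTrace T w x ∂(surf d)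

end CauchyFEM

end

/-!
The divergence theorem on a simplex comes from radial vector fields: for smooth `φ`, the field
`φ(x) (x - p)` with `p` a vertex has flux only through the facet opposite to `p`, and integrating it
over the cone over that facet bounds traces by `H¹` norms. Density of smooth functions, obtained
by shrinking a simplex into its interior before mollifying, then gives traces and integration by
parts on every element. Tested against smooth functions with compact support in `Ω`, the
elementwise formulas show that the jumps of an `H¹` function across interior facets vanish, so
summing over the elements yields Green's formula on `Ω`.

By Green's formula, consistency for `u` says that the integrals of `(∇u·n) φ` and `(∇φ·n) u` over
`ΓV` vanish. Only `∇u·n = 0` on `ΓV` for weak solutions is not part of the hypotheses, and it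
follows by testing with smooth functions supported away from the closure of `ΓW`.
-/

noncomputable section

namespace CauchyFEM

variable {d : ℕ}

/-! ### Simplices in barycentric coordinates -/

section Simplex

variable {ι : Type*} (b : AffineBasis ι ℝ (Euc d))

/-- The closed simplex spanned by an affine basis. It is described by the signs of the barycentric
coordinates, which is the form in which the cones over its faces are computed. -/
def simplexBody : Set (Euc d) := {x | ∀ j, 0 ≤ b.coord j x}

/-- The closed face of the simplex `simplexBody b` opposite to the vertex `b i`. -/
def simplexFace (i : ι) : Set (Euc d) := {x | x ∈ simplexBody b ∧ b.coord i x = 0}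

/-- The (constant) gradient of a barycentric coordinate. -/
def coordGrad (i : ι) : Euc d :=
  (InnerProductSpace.toDual ℝ (Euc d)).symm (LinearMap.toContinuousLinearMap (b.coord i).linear)

/-- The altitude of a simplex: the vector from the vertex `b i` to its orthogonal projection on the
opposite face. -/
def altitude (i : ι) : Euc d := -((‖coordGrad b i‖ ^ 2)⁻¹ • coordGrad b i)

/-- The outward unit normal on the face of a simplex opposite to the vertex `b i`. -/
def faceNormal (i : ι) : Euc d := -(‖coordGrad b i‖⁻¹ • coordGrad b i)

lemma inner_coordGrad (i : ι) (y : Euc d) : inner ℝ (coordGrad b i) y = (b.coord i).linear y := by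
  simp [coordGrad]

lemma coord_add (i : ι) (x y : Euc d) :
    b.coord i (x + y) = b.coord i x + inner ℝ (coordGrad b i) y := by
  rw [inner_coordGrad, add_comm x y, ← vadd_eq_add, AffineMap.map_vadd, vadd_eq_add, add_comm]

lemma coord_eq_add_inner_sub (i : ι) (x y : Euc d) :
    b.coord i y = b.coord i x + inner ℝ (coordGrad b i) (y - x) := by
  rw [← coord_add, add_sub_cancel]

lemma coord_vertex_nonneg (i j : ι) : 0 ≤ b.coord j (b i) := by
  classical
  rw [b.coord_apply]
  split_ifs <;> norm_num

lemma coordGrad_ne_zero [Nontrivial ι] (i : ι) : coordGrad b i ≠ 0 := by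
  intro h
  obtain ⟨j, hj⟩ := exists_ne i
  simpa [h, hj.symm] using coord_eq_add_inner_sub b i (b j) (b i)

lemma altitude_ne_zero [Nontrivial ι] (i : ι) : altitude b i ≠ 0 := by
  simpa [altitude] using coordGrad_ne_zero b i

lemma norm_altitude (i : ι) : ‖altitude b i‖ = ‖coordGrad b i‖⁻¹ := by
  by_cases h : ‖coordGrad b i‖ = 0
  · simp [altitude, h]
  · simp only [altitude, norm_neg, norm_smul, norm_inv, norm_pow, norm_norm]
    field_simp

lemma norm_faceNormal [Nontrivial ι] (i : ι) : ‖faceNormal b i‖ = 1 := by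
  rw [faceNormal, norm_neg, norm_smul, norm_inv, norm_norm,
    inv_mul_cancel₀ (norm_ne_zero_iff.2 (coordGrad_ne_zero b i))]

lemma coordGrad_eq_smul_faceNormal [Nontrivial ι] (i : ι) :
    coordGrad b i = -‖coordGrad b i‖ • faceNormal b i := by
  rw [faceNormal, smul_neg, neg_smul, neg_neg, smul_smul,
    mul_inv_cancel₀ (norm_ne_zero_iff.2 (coordGrad_ne_zero b i)), one_smul]

lemma sum_inner_coordGrad [Fintype ι] (e : Euc d) : ∑ i, inner ℝ (coordGrad b i) e = 0 := by
  have hadd := b.sum_coord_apply_eq_one (0 + e)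
  simp_rw [coord_add, Finset.sum_add_distrib, b.sum_coord_apply_eq_one 0] at hadd
  linarith

lemma sum_inner_coordGrad_smul [Fintype ι] (e : Euc d) :
    ∑ i, inner ℝ (coordGrad b i) e • b i = e := by
  have hadd := b.linear_combination_coord_eq_self (0 + e)
  simp_rw [coord_add, add_smul, Finset.sum_add_distrib,
    b.linear_combination_coord_eq_self 0] at hadd
  exact add_left_cancel hadd

lemma isClosed_simplexBody : IsClosed (simplexBody b) := by
  simp only [simplexBody, ofPred_forall]
  exact isClosed_iInter fun j => isClosed_le continuous_const (continuous_barycentric_coord b j)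

lemma isClosed_simplexFace (i : ι) : IsClosed (simplexFace b i) :=
  (isClosed_simplexBody b).inter (isClosed_eq (continuous_barycentric_coord b i) continuous_const)

lemma simplexBody_eq_convexHull : simplexBody b = convexHull ℝ (range b) :=
  b.convexHull_eq_nonneg_coord.symm

lemma convex_simplexBody : Convex ℝ (simplexBody b) :=
  simplexBody_eq_convexHull b ▸ convex_convexHull ℝ _

lemma nonempty_interior_simplexBody : (interior (simplexBody b)).Nonempty := by
  rw [simplexBody_eq_convexHull, interior_convexHull_nonempty_iff_affineSpan_eq_top, b.tot]

lemma restrict_interior_simplexBody :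
    volume.restrict (interior (simplexBody b)) = volume.restrict (simplexBody b) :=
  Measure.restrict_congr_set (interior_ae_eq_of_null_frontier
    ((convex_simplexBody b).addHaar_frontier volume))

section Finite

variable [Finite ι]

lemma interior_simplexBody : interior (simplexBody b) = {x | ∀ j, 0 < b.coord j x} := by
  rw [simplexBody_eq_convexHull, b.interior_convexHull]

lemma isCompact_simplexBody : IsCompact (simplexBody b) := by
  rw [simplexBody_eq_convexHull]
  exact (finite_range b).isCompact_convexHull ℝ

lemma isCompact_simplexFace (i : ι) : IsCompact (simplexFace b i) :=
  (isCompact_simplexBody b).of_isClosed_subset (isClosed_simplexFace b i) fun _ h => h.1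

lemma isBounded_interior_simplexBody : Bornology.IsBounded (interior (simplexBody b)) :=
  (isCompact_simplexBody b).isBounded.subset interior_subset

lemma coord_le_one {x : Euc d} (hx : x ∈ simplexBody b) (i : ι) : b.coord i x ≤ 1 := by
  cases nonempty_fintype ι
  rw [← b.sum_coord_apply_eq_one x]
  exact Finset.single_le_sum (fun j _ => hx j) (Finset.mem_univ i)

include b in
lemma dim_ne_zero_of_nontrivial [Nontrivial ι] : d ≠ 0 := by
  cases nonempty_fintype ι
  have hcard := b.card_eq_finrank_add_one
  rw [finrank_euclideanSpace_fin] at hcard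
  have := Fintype.one_lt_card (α := ι)
  lia

end Finite

/-! ### Integration over a simplex in polar coordinates centred at a vertex -/

lemma mem_altitude_hyperplane_iff [Nontrivial ι] (i : ι) (τ : ℝ) (x : Euc d) :
    x ∈ AffineSubspace.mk' (τ • altitude b i +ᵥ b i) (Submodule.span ℝ {altitude b i})ᗮ ↔
      b.coord i x = 1 - τ := by
  have hg : ‖coordGrad b i‖ ≠ 0 := norm_ne_zero_iff.2 (coordGrad_ne_zero b i)
  have hsub : x -ᵥ (τ • altitude b i +ᵥ b i) = (x - b i) - τ • altitude b i := by
    rw [vsub_eq_sub, vadd_eq_add]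
    abel
  have hinner : inner ℝ (altitude b i) (x - b i) =
      -((‖coordGrad b i‖ ^ 2)⁻¹ * inner ℝ (coordGrad b i) (x - b i)) := by
    rw [altitude, inner_neg_left, real_inner_smul_left]
  rw [AffineSubspace.mem_mk', Submodule.mem_orthogonal_singleton_iff_inner_right,
    coord_eq_add_inner_sub b i (b i) x, b.coord_apply_eq, hsub, inner_sub_right, inner_smul_right,
    real_inner_self_eq_norm_sq, norm_altitude, hinner]
  field_simp
  constructor <;> intro h <;> linarith

lemma coord_homothety (i j : ι) (τ : ℝ) (z : Euc d) :
    b.coord j (AffineMap.homothety (b i) τ z) =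
      (1 - τ) * b.coord j (b i) + τ * b.coord j z := by
  rw [AffineMap.homothety_eq_lineMap, AffineMap.apply_lineMap, AffineMap.lineMap_apply_ring]

lemma homothety_mem_simplexBody {i : ι} {τ : ℝ} (h0 : 0 ≤ τ) (h1 : τ ≤ 1) {z : Euc d}
    (hz : z ∈ simplexBody b) : AffineMap.homothety (b i) τ z ∈ simplexBody b := fun j => by
  rw [coord_homothety]
  exact add_nonneg (mul_nonneg (sub_nonneg.2 h1) (coord_vertex_nonneg b i j))
    (mul_nonneg h0 (hz j))

lemma simplexBody_slice_eq_image [Nontrivial ι] (i : ι) {τ : ℝ} (h0 : 0 < τ) (h1 : τ ≤ 1)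
    (A : Set (Euc d)) :
    (simplexBody b ∩ A) ∩
        AffineSubspace.mk' (τ • altitude b i +ᵥ b i) (Submodule.span ℝ {altitude b i})ᗮ =
      AffineMap.homothety (b i) τ '' (simplexFace b i ∩ AffineMap.homothety (b i) τ ⁻¹' A) := by
  ext x
  simp only [mem_inter_iff, SetLike.mem_coe, mem_altitude_hyperplane_iff, mem_image, mem_preimage]
  constructor
  · rintro ⟨⟨hx, hA⟩, hi⟩
    have hinv : AffineMap.homothety (b i) τ (AffineMap.homothety (b i) τ⁻¹ x) = x := by
      rw [← AffineMap.homothety_mul_apply, mul_inv_cancel₀ h0.ne', AffineMap.homothety_one,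
        AffineMap.id_apply]
    have hci : b.coord i (AffineMap.homothety (b i) τ⁻¹ x) = 0 := by
      rw [coord_homothety, b.coord_apply_eq, hi]
      field_simp
      ring
    refine ⟨AffineMap.homothety (b i) τ⁻¹ x, ⟨⟨fun j => ?_, hci⟩, by rwa [hinv]⟩, hinv⟩
    obtain rfl | hj := eq_or_ne j i
    · rw [hci]
    · rw [coord_homothety, b.coord_apply_ne hj, mul_zero, zero_add]
      exact mul_nonneg (inv_nonneg.2 h0.le) (hx j)
  · rintro ⟨z, ⟨⟨hz, hzi⟩, hA⟩, rfl⟩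
    refine ⟨⟨homothety_mem_simplexBody b h0.le h1 hz, hA⟩, ?_⟩
    rw [coord_homothety, b.coord_apply_eq, hzi]
    ring

lemma volume_simplexBody_inter [Finite ι] [Nontrivial ι] (i : ι) {A : Set (Euc d)}
    (hA : MeasurableSet A) :
    volume (simplexBody b ∩ A) = ‖altitude b i‖ₑ * ∫⁻ τ in Ioo (0 : ℝ) 1,
      ENNReal.ofReal (τ ^ (d - 1)) *
        surf d (simplexFace b i ∩ AffineMap.homothety (b i) τ ⁻¹' A) := by
  have hslices := EuclideanGeometry.euclideanHausdorffMeasure_eq_lintegral (V := Euc d) (b i)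
    (altitude_ne_zero b i) ((isClosed_simplexBody b).measurableSet.inter hA)
  rw [InnerProductSpace.euclideanHausdorffMeasure_eq_volume, finrank_euclideanSpace_fin] at hslices
  rw [hslices, ← lintegral_indicator measurableSet_Ioo]
  congr 1
  refine lintegral_congr_ae ?_
  filter_upwards [volume.ae_ne 0, volume.ae_ne 1] with τ hτ0 hτ1
  by_cases hτ : τ ∈ Ioo (0 : ℝ) 1
  · rw [indicator_of_mem hτ, simplexBody_slice_eq_image b i hτ.1 hτ.2.le,
      euclideanHausdorffMeasure_homothety_image _ _ hτ.1.ne', surf, ENNReal.smul_def, smul_eq_mul,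
      ENNReal.coe_pow, ENNReal.ofReal_pow hτ.1.le, ← enorm_eq_nnnorm, Real.enorm_eq_ofReal hτ.1.le]
  · rw [indicator_of_notMem hτ]
    convert measure_empty (μ := (μHE[d - 1] : Measure (Euc d)))
    rw [eq_empty_iff_forall_notMem]
    rintro x ⟨⟨hx, -⟩, hslice⟩
    rw [SetLike.mem_coe, mem_altitude_hyperplane_iff] at hslice
    have hle := coord_le_one b hx i
    have hnonneg := hx i
    exact hτ ⟨lt_of_le_of_ne (by linarith) hτ0.symm, lt_of_le_of_ne (by linarith) hτ1⟩

lemma lintegral_Ioo_zero_one_pow_ne_zero (n : ℕ) :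
    ∫⁻ τ in Ioo (0 : ℝ) 1, ENNReal.ofReal (τ ^ n) ≠ 0 := by
  refine (setLIntegral_pos_iff (by fun_prop)).2 ?_ |>.ne'
  have hsub : Ioo (0 : ℝ) 1 ⊆ Function.support fun τ : ℝ => ENNReal.ofReal (τ ^ n) :=
    fun τ hτ => (ENNReal.ofReal_pos.2 (pow_pos hτ.1 n)).ne'
  rw [inter_eq_right.2 hsub]
  simp

lemma surf_simplexFace_lt_top [Finite ι] [Nontrivial ι] (i : ι) : surf d (simplexFace b i) < ⊤ := by
  rw [lt_top_iff_ne_top]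
  intro htop
  have hvol := volume_simplexBody_inter b i MeasurableSet.univ
  simp only [inter_univ, preimage_univ, htop] at hvol
  rw [lintegral_mul_const _ (by fun_prop),
    ENNReal.mul_top (lintegral_Ioo_zero_one_pow_ne_zero _),
    ENNReal.mul_top (by simp [altitude_ne_zero])] at hvol
  exact (isCompact_simplexBody b).measure_lt_top.ne hvol

instance isFiniteMeasure_surf_simplexFace [Finite ι] [Nontrivial ι] (i : ι) :
    IsFiniteMeasure ((surf d).restrict (simplexFace b i)) :=
  ⟨by simpa using surf_simplexFace_lt_top b i⟩

lemma volume_simplexFace (i : ι) : volume (simplexFace b i) = 0 := by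
  let S : AffineSubspace ℝ (Euc d) := (AffineSubspace.mk' (0 : ℝ) ⊥).comap (b.coord i)
  have hS : S ≠ ⊤ := by
    intro h
    have : b i ∈ S := h ▸ AffineSubspace.mem_top ℝ _ _
    simp [S, AffineSubspace.mem_mk'] at this
  refine measure_mono_null (fun x hx => ?_) (Measure.addHaar_affineSubspace volume S hS)
  simpa [S, AffineSubspace.mem_mk'] using hx.2

/-- The face opposite to `b j` contains the cone with apex `b i` over its intersection with the face
opposite to `b i`; this cone has zero volume, so its base has zero surface. -/
lemma surf_simplexFace_inter_eq_zero [Finite ι] [Nontrivial ι] {i j : ι} (hij : i ≠ j) :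
    surf d (simplexFace b i ∩ simplexFace b j) = 0 := by
  have hvol := volume_simplexBody_inter b i (isClosed_simplexFace b j).measurableSet
  rw [measure_mono_null inter_subset_right (volume_simplexFace b j)] at hvol
  have hzero := (mul_eq_zero.1 hvol.symm).resolve_left (by simp [altitude_ne_zero])
  have hcone : ∀ τ ∈ Ioo (0 : ℝ) 1, simplexFace b i ∩ simplexFace b j ⊆
      simplexFace b i ∩ AffineMap.homothety (b i) τ ⁻¹' simplexFace b j := fun τ hτ x hx =>
    ⟨hx.1, homothety_mem_simplexBody b hτ.1.le hτ.2.le hx.1.1, by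
      rw [coord_homothety, b.coord_apply_ne hij.symm, hx.2.2]
      ring⟩
  have hle : (∫⁻ τ in Ioo (0 : ℝ) 1, ENNReal.ofReal (τ ^ (d - 1))) *
      surf d (simplexFace b i ∩ simplexFace b j) ≤ 0 := by
    rw [← hzero, ← lintegral_mul_const _ (by fun_prop)]
    refine setLIntegral_mono_ae' measurableSet_Ioo (Eventually.of_forall fun τ hτ => ?_)
    exact mul_le_mul_right (measure_mono (hcone τ hτ)) _
  exact (mul_eq_zero.1 (nonpos_iff_eq_zero.1 hle)).resolve_left
    (lintegral_Ioo_zero_one_pow_ne_zero _)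

/-- The radial part `τ ^ (d - 1) dτ` on `(0, 1)` of Lebesgue measure in polar coordinates. -/
def coneMeasure (d : ℕ) : Measure ℝ :=
  (volume.restrict (Ioo (0 : ℝ) 1)).withDensity fun τ => ENNReal.ofReal (τ ^ (d - 1))

instance isFiniteMeasure_coneMeasure : IsFiniteMeasure (coneMeasure d) := by
  refine isFiniteMeasure_withDensity (ne_of_lt ?_)
  calc ∫⁻ τ in Ioo (0 : ℝ) 1, ENNReal.ofReal (τ ^ (d - 1))
      ≤ ∫⁻ _ in Ioo (0 : ℝ) 1, 1 :=
        setLIntegral_mono_ae' measurableSet_Ioo (Eventually.of_forall fun _ hτ =>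
          ENNReal.ofReal_le_one.2 (pow_le_one₀ hτ.1.le hτ.2.le))
    _ < ⊤ := by simp

lemma continuous_homothety_uncurry (p : Euc d) :
    Continuous fun z : ℝ × Euc d => AffineMap.homothety p z.1 z.2 := by
  simp only [AffineMap.homothety_apply, vsub_eq_sub, vadd_eq_add]
  fun_prop

lemma volume_restrict_simplexBody [Finite ι] [Nontrivial ι] (i : ι) :
    volume.restrict (simplexBody b) = ‖altitude b i‖ₑ •
      ((coneMeasure d).prod ((surf d).restrict (simplexFace b i))).map
        fun z => AffineMap.homothety (b i) z.1 z.2 := by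
  ext A hA
  have hm : Measurable fun z : ℝ × Euc d => AffineMap.homothety (b i) z.1 z.2 :=
    (continuous_homothety_uncurry (b i)).measurable
  rw [Measure.restrict_apply hA, inter_comm, volume_simplexBody_inter b i hA,
    Measure.smul_apply, Measure.map_apply hm hA, Measure.prod_apply (hm hA), coneMeasure,
    lintegral_withDensity_eq_lintegral_mul _ (by fun_prop) (measurable_measure_prodMk_left (hm hA)),
    smul_eq_mul]
  congr 1
  refine lintegral_congr fun τ => ?_
  rw [Pi.mul_apply, Measure.restrict_apply (measurable_prodMk_left (hm hA)), inter_comm]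
  rfl

lemma integral_simplexBody_eq_polar [Finite ι] [Nontrivial ι] (i : ι) {f : Euc d → ℝ}
    (hf : Continuous f) :
    ∫ x in simplexBody b, f x = ‖altitude b i‖ * ∫ z in simplexFace b i,
      ∫ τ, f (AffineMap.homothety (b i) τ z) ∂coneMeasure d ∂surf d := by
  have hm := (continuous_homothety_uncurry (b i)).aemeasurable
    (μ := (coneMeasure d).prod ((surf d).restrict (simplexFace b i)))
  have hint := hf.continuousOn.integrableOn_compact (μ := volume) (isCompact_simplexBody b)
  rw [IntegrableOn, volume_restrict_simplexBody b i, integrable_smul_measure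
    (by simp [altitude_ne_zero]) (by simp), integrable_map_measure
    hf.aestronglyMeasurable hm] at hint
  rw [volume_restrict_simplexBody b i, integral_smul_measure,
    integral_map hm hf.aestronglyMeasurable, toReal_enorm, smul_eq_mul]
  exact congrArg _ (integral_prod_symm _ hint)

/-! ### The divergence theorem on a simplex -/

/-- The integrand is the derivative of `τ ^ d * ψ (p + τ (z - p))`. -/
lemma integral_coneMeasure_radial (hd : d ≠ 0) {ψ : Euc d → ℝ} (hψ : ContDiff ℝ 1 ψ)
    (p z : Euc d) :
    ∫ τ, (d * ψ (AffineMap.homothety p τ z) + fderiv ℝ ψ (AffineMap.homothety p τ z)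
      (AffineMap.homothety p τ z - p)) ∂coneMeasure d = ψ z := by
  let γ : ℝ → Euc d := fun τ => AffineMap.homothety p τ z
  have hγ_sub : ∀ τ, γ τ - p = τ • (z - p) := by simp [γ, AffineMap.homothety_apply]
  have hγ_deriv : ∀ τ, HasDerivAt γ (z - p) τ := fun τ => by
    have hγ_eq : γ = fun τ => τ • (z - p) + p := by simp [γ, AffineMap.homothety_apply]
    simpa [hγ_eq] using ((hasDerivAt_id τ).smul_const (z - p)).add_const p
  have hγ_cont : Continuous γ := continuous_iff_continuousAt.2 fun τ => (hγ_deriv τ).continuousAt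
  have hprim : ∀ τ ∈ uIcc (0 : ℝ) 1, HasDerivAt (fun τ => τ ^ d * ψ (γ τ))
      (d * τ ^ (d - 1) * ψ (γ τ) + τ ^ d * fderiv ℝ ψ (γ τ) (z - p)) τ := fun τ _ =>
    (hasDerivAt_pow d τ).mul
      ((hψ.differentiable one_ne_zero _).hasFDerivAt.comp_hasDerivAt τ (hγ_deriv τ))
  have hint : IntervalIntegrable (fun τ => d * τ ^ (d - 1) * ψ (γ τ) +
      τ ^ d * fderiv ℝ ψ (γ τ) (z - p)) volume 0 1 := by
    have hfderiv := (hψ.continuous_fderiv one_ne_zero).comp hγ_cont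
    have hcomp := hψ.continuous.comp hγ_cont
    simp only [Function.comp_def] at hfderiv hcomp
    exact Continuous.intervalIntegrable (by fun_prop) _ _
  have hftc := intervalIntegral.integral_eq_sub_of_hasDerivAt hprim hint
  simp only [γ, one_pow, AffineMap.homothety_one, AffineMap.id_apply, one_mul, zero_pow hd,
    zero_mul, sub_zero] at hftc
  rw [coneMeasure, integral_withDensity_eq_integral_toReal_smul (by fun_prop) (by simp),
    ← integral_Ioc_eq_integral_Ioo, ← intervalIntegral.integral_of_le zero_le_one]
  refine Eq.trans (intervalIntegral.integral_congr fun τ hτ => ?_) hftc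
  rw [uIcc_of_le zero_le_one] at hτ
  obtain ⟨m, rfl⟩ := Nat.exists_eq_succ_of_ne_zero hd
  change _ • (_ * ψ (γ τ) + fderiv ℝ ψ (γ τ) (γ τ - p)) = _
  simp only [hγ_sub, map_smul, smul_eq_mul, ENNReal.toReal_ofReal (pow_nonneg hτ.1 _),
    Nat.succ_sub_one, pow_succ]
  ring

lemma integral_simplexBody_radial [Finite ι] [Nontrivial ι] (i : ι) {ψ : Euc d → ℝ}
    (hψ : ContDiff ℝ 1 ψ) :
    ∫ x in simplexBody b, (d * ψ x + fderiv ℝ ψ x (x - b i)) =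
      ‖altitude b i‖ * ∫ x in simplexFace b i, ψ x ∂(surf d) := by
  have hcont : Continuous fun x => (d * ψ x + fderiv ℝ ψ x (x - b i)) := by
    have := hψ.continuous_fderiv one_ne_zero
    have := hψ.continuous
    fun_prop
  rw [integral_simplexBody_eq_polar b i hcont]
  simp_rw [integral_coneMeasure_radial (dim_ne_zero_of_nontrivial b) hψ]

/-- A constant vector `e` is the combination `∑ i, -⟪∇λ i, e⟫ • (x - b i)` of the radial fields. -/
lemma integral_simplexBody_fderiv [Fintype ι] [Nontrivial ι] {ψ : Euc d → ℝ}
    (hψ : ContDiff ℝ 1 ψ) (e : Euc d) :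
    ∫ x in simplexBody b, fderiv ℝ ψ x e =
      ∑ i, inner ℝ (faceNormal b i) e * ∫ x in simplexFace b i, ψ x ∂(surf d) := by
  have hradial : ∀ x, ∑ i, -inner ℝ (coordGrad b i) e • (x - b i) = e := fun x => by
    simp_rw [smul_sub, Finset.sum_sub_distrib, ← Finset.sum_smul, Finset.sum_neg_distrib, neg_smul,
      Finset.sum_neg_distrib, sum_inner_coordGrad, sum_inner_coordGrad_smul]
    simp
  have hintegrable : ∀ i, IntegrableOn (fun x => -inner ℝ (coordGrad b i) e *
      (d * ψ x + fderiv ℝ ψ x (x - b i))) (simplexBody b) := fun i => by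
    have := hψ.continuous_fderiv one_ne_zero
    have := hψ.continuous
    exact ContinuousOn.integrableOn_compact (isCompact_simplexBody b) (by fun_prop)
  calc ∫ x in simplexBody b, fderiv ℝ ψ x e
      = ∫ x in simplexBody b, ∑ i, -inner ℝ (coordGrad b i) e *
          (d * ψ x + fderiv ℝ ψ x (x - b i)) := by
        congr 1 with x
        conv_lhs => rw [← hradial x]
        simp_rw [map_sum, map_smul, mul_add, Finset.sum_add_distrib, ← Finset.sum_mul,
          Finset.sum_neg_distrib, sum_inner_coordGrad]
        simp
    _ = ∑ i, -inner ℝ (coordGrad b i) e *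
          (‖altitude b i‖ * ∫ x in simplexFace b i, ψ x ∂(surf d)) := by
        rw [integral_finsetSum _ fun i _ => hintegrable i]
        simp_rw [integral_const_mul, integral_simplexBody_radial b _ hψ]
    _ = _ := by
        simp_rw [norm_altitude, faceNormal, inner_neg_left, real_inner_smul_left]
        exact Finset.sum_congr rfl fun i _ => by ring

end Simplex

/-! ### Convergence in `Lᵖ` -/

section Lp

variable {α κ E : Type*} [MeasurableSpace α] {μ : Measure α} [NormedAddCommGroup E]
  {p : ENNReal} {l : Filter κ}

lemma integral_mul_eq_inner_toLp {f g : α → ℝ} (hf : MemLp f 2 μ) (hg : MemLp g 2 μ) :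
    ∫ x, f x * g x ∂μ = inner ℝ (hf.toLp f) (hg.toLp g) := by
  rw [L2.inner_def]
  refine integral_congr_ae ?_
  filter_upwards [hf.coeFn_toLp, hg.coeFn_toLp] with x hfx hgx
  simp [hfx, hgx, mul_comm]

lemma tendsto_integral_mul_of_tendsto_eLpNorm {f g : κ → α → ℝ} {f₀ g₀ : α → ℝ}
    (hf : ∀ n, MemLp (f n) 2 μ) (hg : ∀ n, MemLp (g n) 2 μ) (hf₀ : MemLp f₀ 2 μ)
    (hg₀ : MemLp g₀ 2 μ) (hfl : Tendsto (fun n => eLpNorm (f n - f₀) 2 μ) l (𝓝 0))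
    (hgl : Tendsto (fun n => eLpNorm (g n - g₀) 2 μ) l (𝓝 0)) :
    Tendsto (fun n => ∫ x, f n x * g n x ∂μ) l (𝓝 (∫ x, f₀ x * g₀ x ∂μ)) := by
  simp_rw [integral_mul_eq_inner_toLp (hf _) (hg _), integral_mul_eq_inner_toLp hf₀ hg₀]
  exact ((Lp.tendsto_Lp_iff_tendsto_eLpNorm'' f hf f₀ hf₀).2 hfl).inner
    ((Lp.tendsto_Lp_iff_tendsto_eLpNorm'' g hg g₀ hg₀).2 hgl)

lemma exists_tendsto_eLpNorm_of_cauchy [CompleteSpace E] [Fact (1 ≤ p)] {f : ℕ → α → E}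
    (hf : ∀ n, MemLp (f n) p μ)
    (hcauchy : Tendsto (fun m : ℕ × ℕ => eLpNorm (f m.1 - f m.2) p μ) atTop (𝓝 0)) :
    ∃ f₀, MemLp f₀ p μ ∧ Tendsto (fun n => eLpNorm (f n - f₀) p μ) atTop (𝓝 0) := by
  have hseq : CauchySeq fun n => (hf n).toLp (f n) :=
    (Lp.cauchySeq_Lp_iff_cauchySeq_eLpNorm _).2 <| hcauchy.congr fun m =>
      eLpNorm_congr_ae ((hf m.1).coeFn_toLp.sub (hf m.2).coeFn_toLp).symm
  obtain ⟨F, hF⟩ := cauchySeq_tendsto_of_complete hseq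
  refine ⟨F, Lp.memLp F, ?_⟩
  rw [← Lp.toLp_coeFn F (Lp.memLp F)] at hF
  exact (Lp.tendsto_Lp_iff_tendsto_eLpNorm'' f hf F (Lp.memLp F)).1 hF

lemma tendsto_eLpNorm_sub_sub (hp : 1 ≤ p) {f f' : κ → α → E} {g g' : α → E}
    (hf : ∀ n, AEStronglyMeasurable (f n) μ) (hf' : ∀ n, AEStronglyMeasurable (f' n) μ)
    (hg : AEStronglyMeasurable g μ) (hg' : AEStronglyMeasurable g' μ)
    (h : Tendsto (fun n => eLpNorm (f n - g) p μ) l (𝓝 0))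
    (h' : Tendsto (fun n => eLpNorm (f' n - g') p μ) l (𝓝 0)) :
    Tendsto (fun n => eLpNorm (f n - f' n - (g - g')) p μ) l (𝓝 0) := by
  refine tendsto_of_tendsto_of_tendsto_of_le_of_le tendsto_const_nhds (by simpa using h.add h')
    (fun _ => bot_le) fun n => ?_
  simp only [sub_sub_sub_comm (f n)]
  exact eLpNorm_sub_le ((hf n).sub hg) ((hf' n).sub hg') hp

lemma ae_eq_of_tendsto_eLpNorm_sub [l.NeBot] (hp : 1 ≤ p) {f : κ → α → E} {g g' : α → E}
    (hf : ∀ n, AEStronglyMeasurable (f n) μ) (hg : AEStronglyMeasurable g μ)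
    (hg' : AEStronglyMeasurable g' μ) (h : Tendsto (fun n => eLpNorm (f n - g) p μ) l (𝓝 0))
    (h' : Tendsto (fun n => eLpNorm (f n - g') p μ) l (𝓝 0)) : g =ᵐ[μ] g' := by
  have hconst := tendsto_eLpNorm_sub_sub hp hf hf hg hg' h h'
  simp only [sub_self, zero_sub, eLpNorm_neg, tendsto_const_nhds_iff] at hconst
  exact (sub_ae_eq_zero _ _).1
    ((eLpNorm_eq_zero_iff (hg.sub hg') (one_pos.trans_le hp).ne').1 hconst)

lemma tendsto_eLpNorm_sub_of_tendsto (hp : 1 ≤ p) {f : ℕ → α → E} {g : α → E}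
    (hf : ∀ n, AEStronglyMeasurable (f n) μ) (hg : AEStronglyMeasurable g μ)
    (h : Tendsto (fun n => eLpNorm (f n - g) p μ) atTop (𝓝 0)) :
    Tendsto (fun m : ℕ × ℕ => eLpNorm (f m.1 - f m.2) p μ) atTop (𝓝 0) := by
  rw [← prod_atTop_atTop_eq]
  simpa only [sub_self, sub_zero, Function.comp_def] using
    tendsto_eLpNorm_sub_sub (f := f ∘ Prod.fst) (f' := f ∘ Prod.snd) hp (fun m => hf m.1)
      (fun m => hf m.2) hg hg (h.comp tendsto_fst) (h.comp tendsto_snd)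

lemma tendsto_eLpNorm_restrict_of_subset {s t : Set α} (hst : s ⊆ t) {f : κ → α → E}
    (h : Tendsto (fun n => eLpNorm (f n) p (μ.restrict t)) l (𝓝 0)) :
    Tendsto (fun n => eLpNorm (f n) p (μ.restrict s)) l (𝓝 0) :=
  tendsto_of_tendsto_of_tendsto_of_le_of_le tendsto_const_nhds h (fun _ => bot_le)
    fun _ => eLpNorm_mono_measure _ (Measure.restrict_mono hst le_rfl)

lemma setIntegral_mul_eq_integral_of_tsupport_subset [TopologicalSpace α] {D : Set α}
    {f g : α → ℝ} (hg : tsupport g ⊆ D) : ∫ x in D, f x * g x ∂μ = ∫ x, f x * g x ∂μ :=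
  setIntegral_eq_integral_of_forall_compl_eq_zero fun x hx => by
    rw [image_eq_zero_of_notMem_tsupport fun hx' => hx (hg hx'), mul_zero]

end Lp

/-! ### Weak derivatives -/

lemma continuous_partialDeriv {ψ : Euc d → ℝ} (hψ : ContDiff ℝ ∞ ψ) (i : Fin d) :
    Continuous (partialDeriv i ψ) := by
  have := hψ.continuous_fderiv (by simp)
  unfold partialDeriv
  fun_prop

lemma hasCompactSupport_partialDeriv {ψ : Euc d → ℝ} (hc : HasCompactSupport ψ) (i : Fin d) :
    HasCompactSupport (partialDeriv i ψ) :=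
  hc.fderiv_apply (𝕜 := ℝ) _

lemma tsupport_partialDeriv_subset (ψ : Euc d → ℝ) (i : Fin d) :
    tsupport (partialDeriv i ψ) ⊆ tsupport ψ :=
  tsupport_fderiv_apply_subset ℝ _

lemma partialDeriv_mul {f g : Euc d → ℝ} (hf : ContDiff ℝ ∞ f) (hg : ContDiff ℝ ∞ g) (i : Fin d)
    (x : Euc d) : partialDeriv i (fun y => f y * g y) x =
      f x * partialDeriv i g x + g x * partialDeriv i f x := by
  simp [partialDeriv,
    fderiv_fun_mul (hf.differentiable (by simp) x) (hg.differentiable (by simp) x)]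

lemma integral_mul_partialDeriv_eq_neg {φ ψ : Euc d → ℝ} (hφ : ContDiff ℝ ∞ φ)
    (hψ : ContDiff ℝ ∞ ψ) (hc : HasCompactSupport ψ) (i : Fin d) :
    ∫ x, φ x * partialDeriv i ψ x = -∫ x, partialDeriv i φ x * ψ x :=
  integral_mul_fderiv_eq_neg_fderiv_mul_of_integrable
    (((continuous_partialDeriv hφ i).mul hψ.continuous).integrable_of_hasCompactSupport
      hc.mul_left)
    ((hφ.continuous.mul (continuous_partialDeriv hψ i)).integrable_of_hasCompactSupport
      (hasCompactSupport_partialDeriv hc i).mul_left)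
    ((hφ.continuous.mul hψ.continuous).integrable_of_hasCompactSupport hc.mul_left)
    (fun x _ => hφ.differentiable (by simp) x) (fun x _ => hψ.differentiable (by simp) x)

lemma memLp_of_continuous_of_isBounded {D : Set (Euc d)} (hD : Bornology.IsBounded D)
    {μ : Measure (Euc d)} [IsFiniteMeasure (μ.restrict D)] {p : ENNReal} {f : Euc d → ℝ}
    (hf : Continuous f) : MemLp f p (μ.restrict D) := by
  obtain ⟨C, hC⟩ := (hD.isCompact_closure.image hf).isBounded.exists_norm_le
  refine MemLp.of_bound hf.aestronglyMeasurable C ?_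
  refine ae_restrict_of_ae_restrict_of_subset subset_closure ?_
  exact ae_restrict_of_forall_mem isClosed_closure.measurableSet fun x hx =>
    hC _ (mem_image_of_mem f hx)

lemma isFiniteMeasure_restrict_volume {D : Set (Euc d)} (hD : Bornology.IsBounded D) :
    IsFiniteMeasure (volume.restrict D) := ⟨by simpa using hD.measure_lt_top⟩

section Weak

variable {D U : Set (Euc d)} {i : Fin d} {v w g g' : Euc d → ℝ}

lemma MemL2.integrable_mul_of_hasCompactSupport (hv : MemL2 D v) {ψ : Euc d → ℝ}
    (hψ : Continuous ψ) (hc : HasCompactSupport ψ) :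
    Integrable (fun x => v x * ψ x) (volume.restrict D) :=
  MemLp.integrable_mul (q := 2) hv ((hψ.memLp_of_hasCompactSupport hc).restrict D)

lemma MemL2.locallyIntegrableOn (hv : MemL2 D v) : LocallyIntegrableOn v D :=
  locallyIntegrableOn_of_locallyIntegrable_restrict (MemLp.locallyIntegrable hv (by norm_num))

lemma integrable_mul_of_tsupport_subset (hv : LocallyIntegrableOn v D) {ψ : Euc d → ℝ}
    (hψ : Continuous ψ) (hc : HasCompactSupport ψ) (hsupp : tsupport ψ ⊆ D) :
    Integrable fun x => v x * ψ x :=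
  ((hv.integrableOn_compact_subset hsupp hc).mul_continuousOn hψ.continuousOn
    hc).integrable_of_forall_notMem_eq_zero fun x hx => by
      rw [image_eq_zero_of_notMem_tsupport hx, mul_zero]

lemma ae_eq_of_setIntegral_mul_eq (hD : IsOpen D) (hv : LocallyIntegrableOn v D)
    (hw : LocallyIntegrableOn w D)
    (h : ∀ ψ : Euc d → ℝ, ContDiff ℝ ∞ ψ → HasCompactSupport ψ → tsupport ψ ⊆ D →
      ∫ x in D, v x * ψ x = ∫ x in D, w x * ψ x) : v =ᵐ[volume.restrict D] w := by
  suffices hzero : ∀ᵐ x, x ∈ D → (v - w) x = 0 by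
    rw [Filter.EventuallyEq, ae_restrict_iff' hD.measurableSet]
    filter_upwards [hzero] with x hx hxD using sub_eq_zero.1 (hx hxD)
  refine hD.ae_eq_zero_of_integral_contDiff_smul_eq_zero (hv.sub hw) fun ψ hψ hc hsupp => ?_
  calc ∫ x, ψ x • (v - w) x
      = ∫ x, (v x * ψ x - w x * ψ x) := by
        simp_rw [Pi.sub_apply, smul_eq_mul, mul_comm (ψ _), sub_mul]
    _ = (∫ x, v x * ψ x) - ∫ x, w x * ψ x :=
        integral_sub (integrable_mul_of_tsupport_subset hv hψ.continuous hc hsupp)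
          (integrable_mul_of_tsupport_subset hw hψ.continuous hc hsupp)
    _ = 0 := by
        rw [← setIntegral_mul_eq_integral_of_tsupport_subset hsupp, h ψ hψ hc hsupp,
          setIntegral_mul_eq_integral_of_tsupport_subset hsupp, sub_self]

lemma IsWeakPartial.ae_unique (hD : IsOpen D) (h : IsWeakPartial D i v g)
    (h' : IsWeakPartial D i v g') : g =ᵐ[volume.restrict D] g' :=
  ae_eq_of_setIntegral_mul_eq hD h.1.locallyIntegrableOn h'.1.locallyIntegrableOn
    fun ψ hψ hc hsupp => neg_inj.1 ((h.2 ψ hψ hc hsupp).symm.trans (h'.2 ψ hψ hc hsupp))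

lemma IsWeakPartial.mono (hU : U ⊆ D) (h : IsWeakPartial D i v g) : IsWeakPartial U i v g := by
  refine ⟨h.1.mono_measure (Measure.restrict_mono hU le_rfl), fun ψ hψ hc hsupp => ?_⟩
  have hsupp' := (tsupport_partialDeriv_subset ψ i).trans hsupp
  have hibp := h.2 ψ hψ hc (hsupp.trans hU)
  rwa [setIntegral_mul_eq_integral_of_tsupport_subset (hsupp.trans hU),
    setIntegral_mul_eq_integral_of_tsupport_subset (hsupp'.trans hU),
    ← setIntegral_mul_eq_integral_of_tsupport_subset hsupp,
    ← setIntegral_mul_eq_integral_of_tsupport_subset hsupp'] at hibp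

lemma IsWeakPartial.add (hv : MemL2 D v) (hw : MemL2 D w) (h : IsWeakPartial D i v g)
    (h' : IsWeakPartial D i w g') : IsWeakPartial D i (v + w) (g + g') := by
  refine ⟨h.1.add h'.1, fun ψ hψ hc hsupp => ?_⟩
  have hψi := continuous_partialDeriv hψ i
  have hci := hasCompactSupport_partialDeriv hc i
  simp only [Pi.add_apply, add_mul]
  rw [integral_add (hv.integrable_mul_of_hasCompactSupport hψi hci)
      (hw.integrable_mul_of_hasCompactSupport hψi hci),
    integral_add (h.1.integrable_mul_of_hasCompactSupport hψ.continuous hc)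
      (h'.1.integrable_mul_of_hasCompactSupport hψ.continuous hc),
    h.2 ψ hψ hc hsupp, h'.2 ψ hψ hc hsupp, neg_add]

lemma isWeakPartial_weakPartial (h : MemH1 D v) (i : Fin d) :
    IsWeakPartial D i v (weakPartial D i v) := by
  rw [weakPartial, dif_pos (h.2 i)]
  exact (h.2 i).choose_spec

lemma MemH1.memL2_weakPartial (h : MemH1 D v) (i : Fin d) : MemL2 D (weakPartial D i v) :=
  (isWeakPartial_weakPartial h i).1

lemma IsWeakPartial.weakPartial_ae_eq (hD : IsOpen D) (h : IsWeakPartial D i v g) :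
    weakPartial D i v =ᵐ[volume.restrict D] g := by
  have hex : ∃ g, IsWeakPartial D i v g := ⟨g, h⟩
  rw [weakPartial, dif_pos hex]
  exact hex.choose_spec.ae_unique hD h

lemma MemH1.mono (hU : U ⊆ D) (h : MemH1 D v) : MemH1 U v :=
  ⟨h.1.mono_measure (Measure.restrict_mono hU le_rfl), fun i =>
    ⟨_, (isWeakPartial_weakPartial h i).mono hU⟩⟩

lemma weakPartial_mono_ae_eq (hUo : IsOpen U) (hU : U ⊆ D) (h : MemH1 D v) (i : Fin d) :
    weakPartial U i v =ᵐ[volume.restrict U] weakPartial D i v :=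
  ((isWeakPartial_weakPartial h i).mono hU).weakPartial_ae_eq hUo

lemma MemH1.add (hv : MemH1 D v) (hw : MemH1 D w) : MemH1 D (v + w) :=
  ⟨hv.1.add hw.1, fun i => ⟨_, (isWeakPartial_weakPartial hv i).add hv.1 hw.1
    (isWeakPartial_weakPartial hw i)⟩⟩

lemma isWeakPartial_partialDeriv (hDb : Bornology.IsBounded D)
    {φ : Euc d → ℝ} (hφ : ContDiff ℝ ∞ φ) (i : Fin d) :
    IsWeakPartial D i φ (partialDeriv i φ) := by
  have := isFiniteMeasure_restrict_volume hDb
  refine ⟨memLp_of_continuous_of_isBounded hDb (continuous_partialDeriv hφ i),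
    fun ψ hψ hc hsupp => ?_⟩
  rw [setIntegral_mul_eq_integral_of_tsupport_subset
      ((tsupport_partialDeriv_subset ψ i).trans hsupp),
    setIntegral_mul_eq_integral_of_tsupport_subset hsupp,
    integral_mul_partialDeriv_eq_neg hφ hψ hc i]

lemma memH1_of_contDiff (hDb : Bornology.IsBounded D)
    {ψ : Euc d → ℝ} (hψ : ContDiff ℝ ∞ ψ) : MemH1 D ψ := by
  have := isFiniteMeasure_restrict_volume hDb
  exact ⟨memLp_of_continuous_of_isBounded hDb hψ.continuous,
    fun i => ⟨_, isWeakPartial_partialDeriv hDb hψ i⟩⟩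

/-- A sequence of smooth functions on the whole space converges to `v` in `H¹(D)`. -/
structure TendstoH1 (D : Set (Euc d)) (ψ : ℕ → Euc d → ℝ) (v : Euc d → ℝ) : Prop where
  smooth : ∀ n, ContDiff ℝ ∞ (ψ n)
  val : Tendsto (fun n => eLpNorm (fun x => ψ n x - v x) 2 (volume.restrict D)) atTop (𝓝 0)
  grad : ∀ i, Tendsto (fun n => eLpNorm (fun x => partialDeriv i (ψ n) x - weakPartial D i v x) 2
    (volume.restrict D)) atTop (𝓝 0)

lemma hasTrace_iff {S : Set (Euc d)} : HasTrace D S v g ↔ MemH1 D v ∧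
    MemLp g 2 ((surf d).restrict S) ∧ ∃ ψ, TendstoH1 D ψ v ∧
      Tendsto (fun n => eLpNorm (fun x => ψ n x - g x) 2 ((surf d).restrict S)) atTop (𝓝 0) :=
  ⟨fun ⟨hv, hg, ψ, hsmooth, hval, hgrad, htrace⟩ =>
      ⟨hv, hg, ψ, ⟨hsmooth, hval, hgrad⟩, htrace⟩,
    fun ⟨hv, hg, ψ, hψ, htrace⟩ => ⟨hv, hg, ψ, hψ.smooth, hψ.val, hψ.grad, htrace⟩⟩

lemma tendstoH1_const (hDo : IsOpen D) (hDb : Bornology.IsBounded D) {ψ : Euc d → ℝ}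
    (hψ : ContDiff ℝ ∞ ψ) : TendstoH1 D (fun _ => ψ) ψ := by
  refine ⟨fun _ => hψ, by simp, fun i => ?_⟩
  have hzero : (fun x => partialDeriv i ψ x - weakPartial D i ψ x) =ᵐ[volume.restrict D] 0 :=
    (sub_ae_eq_zero _ _).2 ((isWeakPartial_partialDeriv hDb hψ i).weakPartial_ae_eq hDo).symm
  simp [eLpNorm_congr_ae hzero]

lemma TendstoH1.mono {ψ : ℕ → Euc d → ℝ} (h : TendstoH1 D ψ v) (hv : MemH1 D v) (hUo : IsOpen U)
    (hU : U ⊆ D) : TendstoH1 U ψ v := by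
  refine ⟨h.smooth, tendsto_eLpNorm_restrict_of_subset hU h.val, fun i =>
    (tendsto_eLpNorm_restrict_of_subset hU (h.grad i)).congr fun n => eLpNorm_congr_ae ?_⟩
  filter_upwards [weakPartial_mono_ae_eq hUo hU hv i] with x hx
  rw [hx]

lemma HasTrace.mono {S S' : Set (Euc d)} (h : HasTrace D S v g) (hUo : IsOpen U) (hU : U ⊆ D)
    (hS : S' ⊆ S) : HasTrace U S' v g := by
  obtain ⟨hv, hg, ψ, hψ, htrace⟩ := hasTrace_iff.1 h
  exact hasTrace_iff.2 ⟨hv.mono hU, hg.mono_measure (Measure.restrict_mono hS le_rfl), ψ,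
    hψ.mono hv hUo hU, tendsto_eLpNorm_restrict_of_subset hS htrace⟩

lemma HasTrace.congr {S : Set (Euc d)} (h : HasTrace D S v g)
    (hg : g =ᵐ[(surf d).restrict S] g') : HasTrace D S v g' := by
  obtain ⟨hv, hgL2, ψ, hψ, htrace⟩ := hasTrace_iff.1 h
  refine hasTrace_iff.2 ⟨hv, hgL2.ae_eq hg, ψ, hψ, htrace.congr fun n => eLpNorm_congr_ae ?_⟩
  filter_upwards [hg] with x hx
  rw [hx]

lemma hasTrace_of_contDiff {S : Set (Euc d)} (hDo : IsOpen D) (hDb : Bornology.IsBounded D)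
    {ψ : Euc d → ℝ} (hψ : ContDiff ℝ ∞ ψ) (hS : MemLp ψ 2 ((surf d).restrict S)) :
    HasTrace D S ψ ψ :=
  hasTrace_iff.2 ⟨memH1_of_contDiff hDb hψ, hS, fun _ => ψ, tendstoH1_const hDo hDb hψ, by simp⟩

end Weak

/-! ### Density of smooth functions in `H¹` of a convex domain -/

section Density

lemma map_volume_smul_add {c : ℝ} (hc : c ≠ 0) (w : Euc d) :
    (volume : Measure (Euc d)).map (fun x => c • x + w) =
      ENNReal.ofReal |(c ^ d)⁻¹| • volume := by
  have hcomp : (fun x : Euc d => c • x + w) = (fun x => x + w) ∘ fun x => c • x := rfl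
  rw [hcomp, ← Measure.map_map (by fun_prop) (by fun_prop), Measure.map_addHaar_smul _ hc,
    Measure.map_smul, map_add_right_eq_self]
  simp

lemma quasiMeasurePreserving_smul_add {c : ℝ} (hc : c ≠ 0) (w : Euc d) :
    Measure.QuasiMeasurePreserving (fun x : Euc d => c • x + w) volume volume :=
  ⟨by fun_prop, by rw [map_volume_smul_add hc w]; exact Measure.smul_absolutelyContinuous⟩

section DilateNorm

variable {p : ENNReal} {c : ℝ} {f : Euc d → ℝ}

lemma eLpNorm_comp_smul_add (hp : p ≠ ⊤) (hc : c ≠ 0) (w : Euc d)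
    (hf : AEStronglyMeasurable f volume) :
    eLpNorm (fun x => f (c • x + w)) p volume =
      ENNReal.ofReal |(c ^ d)⁻¹| ^ (1 / p).toReal * eLpNorm f p volume := by
  rw [← smul_eq_mul, ← eLpNorm_smul_measure_of_ne_top hp, ← map_volume_smul_add hc w,
    eLpNorm_map_measure _ (by fun_prop)]
  · rfl
  · rw [map_volume_smul_add hc w]
    exact hf.smul_measure _

lemma memLp_comp_smul_add (hp : p ≠ ⊤) (hc : c ≠ 0) (w : Euc d) (hf : MemLp f p volume) :
    MemLp (fun x => f (c • x + w)) p volume := by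
  refine ⟨hf.1.comp_quasiMeasurePreserving (quasiMeasurePreserving_smul_add hc w), ?_⟩
  rw [eLpNorm_comp_smul_add hp hc w hf.1]
  exact ENNReal.mul_lt_top (ENNReal.rpow_lt_top_of_nonneg (by positivity) (by simp)) hf.2

lemma eLpNorm_comp_smul_add_le (hp : p ≠ ⊤) (hc : 1 / 2 ≤ c) (w : Euc d)
    (hf : AEStronglyMeasurable f volume) :
    eLpNorm (fun x => f (c • x + w)) p volume ≤
      ENNReal.ofReal (2 ^ d) ^ (1 / p).toReal * eLpNorm f p volume := by
  have hc0 : 0 < c := by linarith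
  rw [eLpNorm_comp_smul_add hp hc0.ne' w hf]
  gcongr
  rw [abs_of_pos (by positivity), inv_eq_one_div, div_le_iff₀ (by positivity), ← mul_pow]
  exact one_le_pow₀ (by linarith)

end DilateNorm

/-- A smooth probability density with compact support in `D`, used as the weight of an averaging
operator. -/
structure IsSmoothDensity (D : Set (Euc d)) (ρ : Euc d → ℝ) : Prop where
  smooth : ContDiff ℝ ∞ ρ
  compact : HasCompactSupport ρ
  supp : tsupport ρ ⊆ D
  nonneg : ∀ x, 0 ≤ ρ x
  integral : ∫ x, ρ x = 1

lemma exists_isSmoothDensity {D : Set (Euc d)} (hD : IsOpen D) (hne : D.Nonempty) :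
    ∃ ρ, IsSmoothDensity D ρ := by
  obtain ⟨c, hc⟩ := hne
  obtain ⟨r, hr, hrD⟩ := Metric.nhds_basis_closedBall.mem_iff.1 (hD.mem_nhds hc)
  let φ : ContDiffBump c := ⟨r / 2, r, by positivity, by linarith⟩
  refine ⟨φ.normed volume, φ.contDiff_normed, φ.hasCompactSupport_normed, ?_, φ.nonneg_normed,
    φ.integral_normed⟩
  rw [φ.tsupport_normed_eq]
  exact hrD

/-- The weighted mean of the values of `f` on the copy of the support of `ρ` that is contracted
towards `x` by the factor `t`. For `x` in a convex set that contains the support of `ρ` only values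
of `f` in that set enter, so this mollifies up to the boundary. -/
def smear (ρ : Euc d → ℝ) (t : ℝ) (f : Euc d → ℝ) (x : Euc d) : ℝ :=
  ∫ y, ρ y * f ((1 - t) • x + t • y)

/-- The kernel `k` for which `smear ρ t f x` is the convolution of `f` and `k` at `(1 - t) x`. -/
def smearKernel (ρ : Euc d → ℝ) (t : ℝ) (w : Euc d) : ℝ := (t ^ d)⁻¹ * ρ (-(t⁻¹ • w))

variable {D : Set (Euc d)} {ρ f v g : Euc d → ℝ} {t : ℝ}

lemma smear_eq_integral (ht : 0 < t) (x : Euc d) :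
    smear ρ t f x = ∫ z, f z * smearKernel ρ t ((1 - t) • x - z) := by
  rw [← integral_add_left_eq_self _ ((1 - t) • x)]
  have hscale := Measure.integral_comp_smul_of_nonneg (volume : Measure (Euc d))
    (fun z => f ((1 - t) • x + z) * smearKernel ρ t ((1 - t) • x - ((1 - t) • x + z))) t
    (hR := ht.le)
  rw [finrank_euclideanSpace, Fintype.card_fin, smul_eq_mul, eq_comm,
    inv_mul_eq_iff_eq_mul₀ (by positivity)] at hscale
  rw [hscale, ← integral_const_mul, smear]
  refine integral_congr_ae (Eventually.of_forall fun y => ?_)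
  have harg : -(t⁻¹ • ((1 - t) • x - ((1 - t) • x + t • y))) = y := by
    rw [sub_add_cancel_left, smul_neg, neg_neg, smul_smul, inv_mul_cancel₀ ht.ne', one_smul]
  simp only [smearKernel, harg]
  field_simp

lemma smear_congr_ae (ht : 0 < t) (h : f =ᵐ[volume] g) : smear ρ t f = smear ρ t g := by
  ext x
  rw [smear_eq_integral ht, smear_eq_integral ht]
  refine integral_congr_ae ?_
  filter_upwards [h] with z hz
  rw [hz]

lemma contDiff_smearKernel (hρ : ContDiff ℝ ∞ ρ) : ContDiff ℝ ∞ (smearKernel ρ t) :=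
  contDiff_const.mul (hρ.comp (by fun_prop : ContDiff ℝ ∞ fun w : Euc d => -(t⁻¹ • w)))

lemma hasCompactSupport_smearKernel (ht : 0 < t) (hρ : HasCompactSupport ρ) :
    HasCompactSupport (smearKernel ρ t) :=
  HasCompactSupport.mul_left <| hρ.comp_homeomorph
    ((Homeomorph.smulOfNeZero t⁻¹ (inv_ne_zero ht.ne')).trans (Homeomorph.neg (Euc d)))

lemma tsupport_smearKernel_sub_subset (hconv : Convex ℝ D) (ht : 0 < t) (ht1 : t < 1)
    (hρ : IsSmoothDensity D ρ) {x : Euc d} (hx : x ∈ D) :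
    tsupport (fun z => smearKernel ρ t ((1 - t) • x - z)) ⊆ D := by
  have hclosed : IsClosed ((fun y => (1 - t) • x + t • y) '' tsupport ρ) :=
    (hρ.compact.isCompact.image (by fun_prop)).isClosed
  refine (closure_minimal ?_ hclosed).trans ?_
  · intro z hz
    have hρz : ρ (-(t⁻¹ • ((1 - t) • x - z))) ≠ 0 := fun h0 => hz (by simp [smearKernel, h0])
    refine ⟨_, subset_tsupport ρ hρz, ?_⟩
    simp only [smul_neg, smul_smul, mul_inv_cancel₀ ht.ne', one_smul]
    abel
  · rintro _ ⟨y, hy, rfl⟩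
    exact hconv hx (hρ.supp hy) (by linarith) ht.le (by ring)

lemma smear_eq_convolution (ht : 0 < t) :
    smear ρ t f = fun x => convolution f (smearKernel ρ t) (ContinuousLinearMap.mul ℝ ℝ) volume
      ((1 - t) • x) := by
  ext x
  rw [smear_eq_integral ht, convolution_def]
  rfl

lemma contDiff_smear (ht : 0 < t) (hρ : IsSmoothDensity D ρ) (hf : LocallyIntegrable f volume) :
    ContDiff ℝ ∞ (smear ρ t f) := by
  rw [smear_eq_convolution ht]
  exact ((hasCompactSupport_smearKernel ht hρ.compact).contDiff_convolution_right _ hf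
    (contDiff_smearKernel hρ.smooth)).comp
    (by fun_prop : ContDiff ℝ ∞ fun x : Euc d => (1 - t) • x)

lemma partialDeriv_smear_eq_integral (ht : 0 < t) (hρ : IsSmoothDensity D ρ)
    (hf : LocallyIntegrable f volume) (i : Fin d) (x : Euc d) :
    partialDeriv i (smear ρ t f) x =
      (1 - t) * ∫ z, f z * partialDeriv i (smearKernel ρ t) ((1 - t) • x - z) := by
  have hkc := hasCompactSupport_smearKernel ht hρ.compact
  have hks := contDiff_smearKernel (t := t) hρ.smooth
  have hconv := hkc.hasFDerivAt_convolution_right (ContinuousLinearMap.mul ℝ ℝ) hf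
    (hks.of_le (by simp)) ((1 - t) • x)
  have hdilate : HasFDerivAt (fun x : Euc d => (1 - t) • x)
      ((1 - t) • ContinuousLinearMap.id ℝ _) x := (hasFDerivAt_id x).const_smul (1 - t)
  have hcomp : HasFDerivAt (fun x => convolution f (smearKernel ρ t)
      (ContinuousLinearMap.mul ℝ ℝ) volume ((1 - t) • x)) _ x := hconv.comp x hdilate
  rw [partialDeriv, smear_eq_convolution ht, hcomp.fderiv, ContinuousLinearMap.comp_apply,
    smul_apply, map_smul, smul_eq_mul, ContinuousLinearMap.id_apply,
    convolution_precompR_apply _ hf (hkc.fderiv ℝ) (hks.continuous_fderiv (by simp)),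
    convolution_def]
  rfl

lemma partialDeriv_comp_const_sub (hf : Differentiable ℝ f) (i : Fin d) (a z : Euc d) :
    partialDeriv i (fun z => f (a - z)) z = -partialDeriv i f (a - z) := by
  have hcomp : HasFDerivAt (fun z => f (a - z))
      ((fderiv ℝ f (a - z)).comp (-ContinuousLinearMap.id ℝ (Euc d))) z :=
    (hf _).hasFDerivAt.comp z ((hasFDerivAt_id z).const_sub a)
  simp [partialDeriv, hcomp.fderiv]

lemma memLp_indicator_of_memL2 (hD : IsOpen D) (hv : MemL2 D v) :
    MemLp (D.indicator v) 2 volume := (memLp_indicator_iff_restrict hD.measurableSet).2 hv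

lemma locallyIntegrable_indicator_of_memL2 (hD : IsOpen D) (hv : MemL2 D v) :
    LocallyIntegrable (D.indicator v) volume :=
  (memLp_indicator_of_memL2 hD hv).locallyIntegrable (by norm_num)

lemma integral_indicator_mul {α : Type*} [MeasurableSpace α] {μ : Measure α} {s : Set α}
    (hs : MeasurableSet s) (a c : α → ℝ) :
    ∫ z, s.indicator a z * c z ∂μ = ∫ z in s, a z * c z ∂μ := by
  simp_rw [← integral_indicator hs, ← indicator_mul_left]

lemma partialDeriv_smear_indicator (hD : IsOpen D) (hconv : Convex ℝ D) (ht : 0 < t) (ht1 : t < 1)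
    (hρ : IsSmoothDensity D ρ) {i : Fin d} (hv : MemL2 D v) (h : IsWeakPartial D i v g)
    {x : Euc d} (hx : x ∈ D) :
    partialDeriv i (smear ρ t (D.indicator v)) x = (1 - t) * smear ρ t (D.indicator g) x := by
  have hks := contDiff_smearKernel (t := t) hρ.smooth
  have hibp := h.2 (fun z => smearKernel ρ t ((1 - t) • x - z))
    (hks.comp (contDiff_const.sub contDiff_id))
    ((hasCompactSupport_smearKernel ht hρ.compact).comp_homeomorph
      (Homeomorph.subLeft ((1 - t) • x)))
    (tsupport_smearKernel_sub_subset hconv ht ht1 hρ hx)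
  simp only [partialDeriv_comp_const_sub (hks.differentiable (by simp)), mul_neg, integral_neg,
    neg_inj] at hibp
  rw [partialDeriv_smear_eq_integral ht hρ (locallyIntegrable_indicator_of_memL2 hD hv),
    smear_eq_integral ht, integral_indicator_mul hD.measurableSet,
    integral_indicator_mul hD.measurableSet, hibp]

/-- The probability measure with density `ρ`, against which `smear ρ` averages; it is the measure
to which Jensen's inequality is applied. -/
def densityMeasure (ρ : Euc d → ℝ) : Measure (Euc d) :=
  volume.withDensity fun y => ENNReal.ofReal (ρ y)

lemma IsSmoothDensity.measurable_ofReal (hρ : IsSmoothDensity D ρ) :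
    Measurable fun y => ENNReal.ofReal (ρ y) :=
  hρ.smooth.continuous.measurable.ennreal_ofReal

lemma isProbabilityMeasure_densityMeasure (hρ : IsSmoothDensity D ρ) :
    IsProbabilityMeasure (densityMeasure ρ) := by
  constructor
  rw [densityMeasure, withDensity_apply _ MeasurableSet.univ, Measure.restrict_univ,
    ← ofReal_integral_eq_lintegral_ofReal
      (hρ.smooth.continuous.integrable_of_hasCompactSupport hρ.compact)
      (Eventually.of_forall hρ.nonneg), hρ.integral, ENNReal.ofReal_one]

lemma ae_densityMeasure_mem (hρ : IsSmoothDensity D ρ) : ∀ᵐ y ∂(densityMeasure ρ), y ∈ D := by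
  rw [densityMeasure, ae_withDensity_iff hρ.measurable_ofReal]
  exact Eventually.of_forall fun y hy =>
    hρ.supp (subset_tsupport ρ fun h0 => hy (by simp [h0]))

lemma smear_eq_integral_densityMeasure (hρ : IsSmoothDensity D ρ) (x : Euc d) :
    smear ρ t f x = ∫ y, f ((1 - t) • x + t • y) ∂(densityMeasure ρ) := by
  rw [densityMeasure, integral_withDensity_eq_integral_toReal_smul hρ.measurable_ofReal (by simp),
    smear]
  simp [ENNReal.toReal_ofReal (hρ.nonneg _)]

lemma integrable_densityMeasure (hρ : IsSmoothDensity D ρ) (ht : 0 < t) (hf : MemLp f 2 volume)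
    (x : Euc d) : Integrable (fun y => f ((1 - t) • x + t • y)) (densityMeasure ρ) := by
  rw [densityMeasure, integrable_withDensity_iff_integrable_smul' hρ.measurable_ofReal (by simp)]
  have hprod : Integrable (fun y => ρ y * f (t • y + (1 - t) • x)) volume :=
    MemLp.integrable_mul (p := 2) (q := 2)
      (hρ.smooth.continuous.memLp_of_hasCompactSupport hρ.compact)
      (memLp_comp_smul_add (by norm_num) ht.ne' ((1 - t) • x) hf)
  refine hprod.congr (Eventually.of_forall fun y => ?_)
  simp [ENNReal.toReal_ofReal (hρ.nonneg _), add_comm]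

lemma eLpNorm_two_sq {α : Type*} [MeasurableSpace α] {μ : Measure α} (f : α → ℝ) :
    eLpNorm f 2 μ ^ 2 = ∫⁻ x, ‖f x‖ₑ ^ 2 ∂μ := by
  simpa using eLpNorm_nnreal_pow_eq_lintegral (μ := μ) (f := f) (p := 2) (by norm_num)

lemma enorm_integral_sq_le {α : Type*} [MeasurableSpace α] {μ : Measure α}
    [IsProbabilityMeasure μ] {f : α → ℝ} (hf : AEStronglyMeasurable f μ) :
    ‖∫ x, f x ∂μ‖ₑ ^ 2 ≤ ∫⁻ x, ‖f x‖ₑ ^ 2 ∂μ := by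
  rw [← eLpNorm_two_sq]
  gcongr
  refine (enorm_integral_le_lintegral_enorm f).trans ?_
  rw [← eLpNorm_one_eq_lintegral_enorm]
  exact eLpNorm_le_eLpNorm_of_exponent_le (by norm_num) hf

lemma eLpNorm_smear_sub_le (hρ : IsSmoothDensity D ρ) (ht : 0 < t)
    (hfm : StronglyMeasurable f) (hf : MemLp f 2 volume) {ε : ENNReal}
    (h : ∀ y ∈ D, eLpNorm (fun x => f ((1 - t) • x + t • y) - f x) 2 (volume.restrict D) ≤ ε) :
    eLpNorm (fun x => smear ρ t f x - f x) 2 (volume.restrict D) ≤ ε := by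
  have := isProbabilityMeasure_densityMeasure hρ
  rw [← ENNReal.pow_le_pow_left_iff two_ne_zero, eLpNorm_two_sq]
  have hmean : ∀ x, smear ρ t f x - f x =
      ∫ y, (f ((1 - t) • x + t • y) - f x) ∂(densityMeasure ρ) := by
    intro x
    rw [integral_sub (integrable_densityMeasure hρ ht hf x) (integrable_const _),
      smear_eq_integral_densityMeasure hρ]
    simp
  have hmeas : Measurable fun p : Euc d × Euc d => f ((1 - t) • p.1 + t • p.2) - f p.1 := by
    have := hfm.measurable
    fun_prop
  calc ∫⁻ x in D, ‖smear ρ t f x - f x‖ₑ ^ 2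
      ≤ ∫⁻ x in D, (∫⁻ y, ‖f ((1 - t) • x + t • y) - f x‖ₑ ^ 2 ∂(densityMeasure ρ)) := by
        refine lintegral_mono fun x => ?_
        rw [hmean]
        exact enorm_integral_sq_le (hmeas.comp measurable_prodMk_left).aestronglyMeasurable
    _ = ∫⁻ y, (∫⁻ x in D, ‖f ((1 - t) • x + t • y) - f x‖ₑ ^ 2) ∂(densityMeasure ρ) :=
        lintegral_lintegral_swap (hmeas.enorm.pow_const 2).aemeasurable
    _ ≤ ∫⁻ _, ε ^ 2 ∂(densityMeasure ρ) := by
        refine lintegral_mono_ae ?_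
        filter_upwards [ae_densityMeasure_mem hρ] with y hy
        rw [← eLpNorm_two_sq]
        gcongr
        exact h y hy
    _ = ε ^ 2 := by simp

lemma eventually_dist_dilate_lt (hDb : Bornology.IsBounded D) (hg : UniformContinuous g) {η : ℝ}
    (hη : 0 < η) :
    ∀ᶠ t : ℝ in 𝓝 0, ∀ x ∈ D, ∀ y ∈ D, dist (g ((1 - t) • x + t • y)) (g x) < η := by
  obtain ⟨r, hr, hgr⟩ := Metric.uniformContinuous_iff.1 hg η hη
  obtain ⟨R, hR⟩ := Metric.isBounded_iff.1 hDb
  have hlim : Tendsto (fun t : ℝ => ‖t‖ * R) (𝓝 0) (𝓝 0) := by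
    simpa using (tendsto_norm_zero (E := ℝ)).mul_const R
  filter_upwards [hlim.eventually (gt_mem_nhds hr)] with t ht x hx y hy
  rw [← AffineMap.lineMap_apply_module]
  refine hgr ((dist_lineMap_left x y t).trans_le ?_ |>.trans_lt ht)
  gcongr
  exact hR hx hy

lemma eventually_eLpNorm_dilate_sub_le_of_uniformContinuous {p : ENNReal}
    (hDb : Bornology.IsBounded D) (hg : UniformContinuous g) {ε : ENNReal} (hε : ε ≠ 0) :
    ∀ᶠ t : ℝ in 𝓝 0, ∀ y ∈ D,
      eLpNorm (fun x => g ((1 - t) • x + t • y) - g x) p (volume.restrict D) ≤ ε := by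
  have hfin : (volume.restrict D) univ ^ p.toReal⁻¹ ≠ ⊤ :=
    (ENNReal.rpow_lt_top_of_nonneg (by positivity) (by simpa using hDb.measure_lt_top.ne)).ne
  obtain ⟨η, hη, hηlt⟩ := ENNReal.exists_nnreal_pos_mul_lt hfin hε
  filter_upwards [eventually_dist_dilate_lt hDb.closure hg (NNReal.coe_pos.2 hη)] with t ht y hy
  refine (eLpNorm_le_of_ae_bound (C := η) ?_).trans ?_
  · refine ae_restrict_of_ae_restrict_of_subset (t := closure D) subset_closure ?_
    refine ae_restrict_of_forall_mem isClosed_closure.measurableSet fun x hx => ?_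
    rw [← dist_eq_norm]
    exact (ht x hx y (subset_closure hy)).le
  · rw [mul_comm, ENNReal.ofReal_coe_nnreal]
    exact hηlt.le

lemma eLpNorm_dilate_sub_le {p : ENNReal} (hp1 : 1 ≤ p) (hp : p ≠ ⊤) (ht : t ≤ 1 / 2)
    (hf : AEStronglyMeasurable f volume) (hg : AEStronglyMeasurable g volume) (y : Euc d) :
    eLpNorm (fun x => f ((1 - t) • x + t • y) - f x) p (volume.restrict D) ≤
      ENNReal.ofReal (2 ^ d) ^ (1 / p).toReal * eLpNorm (f - g) p volume +
        eLpNorm (fun x => g ((1 - t) • x + t • y) - g x) p (volume.restrict D) +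
        eLpNorm (f - g) p volume := by
  have hqmp := quasiMeasurePreserving_smul_add (d := d) (c := 1 - t) (by linarith) (t • y)
  have hfg := hf.sub hg
  have hfg' := hfg.comp_quasiMeasurePreserving hqmp
  have hgg' := (hg.comp_quasiMeasurePreserving hqmp).sub hg
  have hle : volume.restrict D ≤ (volume : Measure (Euc d)) := Measure.restrict_le_self
  have hsplit : (fun x => f ((1 - t) • x + t • y) - f x) =
      ((fun x => (f - g) ((1 - t) • x + t • y)) + fun x => g ((1 - t) • x + t • y) - g x) -
        (f - g) := by
    ext x
    simp only [Pi.sub_apply, Pi.add_apply]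
    ring
  rw [hsplit]
  refine (eLpNorm_sub_le ((hfg'.add hgg').mono_measure hle) (hfg.mono_measure hle) hp1).trans ?_
  refine add_le_add ((eLpNorm_add_le (hfg'.mono_measure hle) (hgg'.mono_measure hle) hp1).trans
    ?_) (eLpNorm_mono_measure _ hle)
  refine add_le_add ?_ le_rfl
  exact (eLpNorm_mono_measure _ hle).trans
    (eLpNorm_comp_smul_add_le hp (by linarith) (t • y) hfg)

lemma eventually_eLpNorm_dilate_sub_le {p : ENNReal} (hp1 : 1 ≤ p) (hp : p ≠ ⊤)
    (hDb : Bornology.IsBounded D) (hf : MemLp f p volume) {ε : ENNReal} (hε : ε ≠ 0) :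
    ∀ᶠ t : ℝ in 𝓝 0, ∀ y ∈ D,
      eLpNorm (fun x => f ((1 - t) • x + t • y) - f x) p (volume.restrict D) ≤ ε := by
  set C : ENNReal := ENNReal.ofReal (2 ^ d) ^ (1 / p).toReal
  have hCtop : C ≠ ⊤ := (ENNReal.rpow_lt_top_of_nonneg (by positivity) (by simp)).ne
  set δ := ε / (C + 1 + 1)
  have hδ : δ ≠ 0 := (ENNReal.div_pos hε (by simp [hCtop])).ne'
  obtain ⟨g, hgc, hfg, hgcont, hg⟩ := hf.exists_hasCompactSupport_eLpNorm_sub_le hp hδ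
  filter_upwards [eventually_eLpNorm_dilate_sub_le_of_uniformContinuous (p := p) hDb
    (hgc.uniformContinuous_of_continuous hgcont) hδ,
    Iic_mem_nhds (show (0 : ℝ) < 1 / 2 by norm_num)] with t hgt ht y hy
  calc eLpNorm (fun x => f ((1 - t) • x + t • y) - f x) p (volume.restrict D)
      ≤ C * δ + δ + δ := (eLpNorm_dilate_sub_le hp1 hp ht hf.1 hg.1 y).trans (by
        gcongr
        exact hgt y hy)
    _ = (C + 1 + 1) * δ := by ring
    _ ≤ ε := ENNReal.mul_div_le

lemma tendsto_eLpNorm_smear_sub (hDb : Bornology.IsBounded D) (hρ : IsSmoothDensity D ρ)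
    (hf : MemLp f 2 volume) :
    Tendsto (fun t => eLpNorm (fun x => smear ρ t f x - f x) 2 (volume.restrict D))
      (𝓝[>] 0) (𝓝 0) := by
  rw [ENNReal.tendsto_nhds_zero]
  intro ε hε
  have hae := hf.1.ae_eq_mk
  have hmk : MemLp (hf.1.mk f) 2 volume := hf.ae_eq hae
  filter_upwards [nhdsWithin_le_nhds (eventually_eLpNorm_dilate_sub_le (by norm_num)
    (by norm_num) hDb hmk hε.ne'), self_mem_nhdsWithin] with t ht ht0
  rw [smear_congr_ae ht0 hae]
  refine (eLpNorm_congr_ae ?_).trans_le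
    (eLpNorm_smear_sub_le hρ ht0 hf.1.stronglyMeasurable_mk hmk ht)
  filter_upwards [ae_restrict_of_ae hae] with x hx
  rw [hx]

lemma tendsto_eLpNorm_smear_indicator_sub (hD : IsOpen D) (hDb : Bornology.IsBounded D)
    (hρ : IsSmoothDensity D ρ) (hv : MemL2 D v) :
    Tendsto (fun t => eLpNorm (fun x => smear ρ t (D.indicator v) x - v x) 2 (volume.restrict D))
      (𝓝[>] 0) (𝓝 0) := by
  refine (tendsto_eLpNorm_smear_sub hDb hρ (memLp_indicator_of_memL2 hD hv)).congr
    fun t => eLpNorm_congr_ae ?_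
  filter_upwards [ae_restrict_mem hD.measurableSet] with x hx
  rw [indicator_of_mem hx]

lemma eLpNorm_partialDeriv_smear_sub_le (hD : IsOpen D) (hconv : Convex ℝ D) (ht : 0 < t)
    (ht1 : t < 1) (hρ : IsSmoothDensity D ρ) {i : Fin d} (hv : MemL2 D v)
    (hg : IsWeakPartial D i v g) :
    eLpNorm (fun x => partialDeriv i (smear ρ t (D.indicator v)) x - g x) 2 (volume.restrict D) ≤
      eLpNorm (fun x => smear ρ t (D.indicator g) x - g x) 2 (volume.restrict D) +
        ENNReal.ofReal t * eLpNorm g 2 (volume.restrict D) := by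
  have hsplit : (fun x => partialDeriv i (smear ρ t (D.indicator v)) x - g x)
      =ᵐ[volume.restrict D]
      ((1 - t) • fun x => smear ρ t (D.indicator g) x - g x) - t • g := by
    filter_upwards [ae_restrict_mem hD.measurableSet] with x hx
    rw [partialDeriv_smear_indicator hD hconv ht ht1 hρ hv hg hx]
    simp only [Pi.sub_apply, Pi.smul_apply, smul_eq_mul]
    ring
  have hmeas : AEStronglyMeasurable (fun x => smear ρ t (D.indicator g) x - g x)
      (volume.restrict D) :=
    (contDiff_smear ht hρ
      (locallyIntegrable_indicator_of_memL2 hD hg.1)).continuous.aestronglyMeasurable.sub hg.1.1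
  refine (eLpNorm_congr_ae hsplit).le.trans ?_
  refine (eLpNorm_sub_le (hmeas.const_smul _) (hg.1.1.const_smul _) (by norm_num)).trans ?_
  rw [eLpNorm_const_smul, eLpNorm_const_smul, Real.enorm_eq_ofReal (by linarith),
    Real.enorm_eq_ofReal ht.le]
  gcongr
  exact mul_le_of_le_one_left bot_le (ENNReal.ofReal_le_one.2 (by linarith))

lemma tendsto_eLpNorm_partialDeriv_smear_sub (hD : IsOpen D) (hDb : Bornology.IsBounded D)
    (hconv : Convex ℝ D) (hρ : IsSmoothDensity D ρ) {i : Fin d} (hv : MemL2 D v)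
    (hg : IsWeakPartial D i v g) :
    Tendsto (fun t => eLpNorm (fun x => partialDeriv i (smear ρ t (D.indicator v)) x - g x) 2
      (volume.restrict D)) (𝓝[>] 0) (𝓝 0) := by
  have hrem : Tendsto (fun t : ℝ => ENNReal.ofReal t * eLpNorm g 2 (volume.restrict D)) (𝓝[>] 0)
      (𝓝 (ENNReal.ofReal 0 * eLpNorm g 2 (volume.restrict D))) :=
    ENNReal.Tendsto.mul_const (ENNReal.tendsto_ofReal (tendsto_id.mono_left nhdsWithin_le_nhds))
      (Or.inr hg.1.2.ne)
  have hbound := (tendsto_eLpNorm_smear_indicator_sub hD hDb hρ hg.1).add hrem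
  rw [ENNReal.ofReal_zero, zero_mul, add_zero] at hbound
  refine tendsto_of_tendsto_of_tendsto_of_le_of_le' tendsto_const_nhds hbound
    (Eventually.of_forall fun _ => bot_le) ?_
  filter_upwards [Ioo_mem_nhdsGT one_pos] with t ht
  exact eLpNorm_partialDeriv_smear_sub_le hD hconv ht.1 ht.2 hρ hv hg

lemma exists_tendstoH1 (hD : IsOpen D) (hne : D.Nonempty) (hDb : Bornology.IsBounded D)
    (hconv : Convex ℝ D) (hv : MemH1 D v) : ∃ ψ, TendstoH1 D ψ v := by
  obtain ⟨ρ, hρ⟩ := exists_isSmoothDensity hD hne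
  obtain ⟨t, -, ht0, ht⟩ := exists_seq_strictAnti_tendsto' (zero_lt_one (α := ℝ))
  have ht' : Tendsto t atTop (𝓝[>] 0) :=
    tendsto_nhdsWithin_iff.2 ⟨ht, Eventually.of_forall fun n => (ht0 n).1⟩
  exact ⟨fun n => smear ρ (t n) (D.indicator v),
    fun n => contDiff_smear (ht0 n).1 hρ (locallyIntegrable_indicator_of_memL2 hD hv.1),
    (tendsto_eLpNorm_smear_indicator_sub hD hDb hρ hv.1).comp ht',
    fun i => (tendsto_eLpNorm_partialDeriv_smear_sub hD hDb hconv hρ hv.1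
      (isWeakPartial_weakPartial hv i)).comp ht'⟩

end Density

/-! ### Traces and integration by parts on a simplex -/

lemma fderiv_eq_sum_partialDeriv (ψ : Euc d → ℝ) (x y : Euc d) :
    fderiv ℝ ψ x y = ∑ i, y i * partialDeriv i ψ x := by
  conv_lhs => rw [← (EuclideanSpace.basisFun (Fin d) ℝ).sum_repr y]
  simp [partialDeriv]

lemma sq_fderiv_le (ψ : Euc d → ℝ) (x y : Euc d) :
    (fderiv ℝ ψ x y) ^ 2 ≤ ‖y‖ ^ 2 * ∑ j, partialDeriv j ψ x ^ 2 := by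
  rw [fderiv_eq_sum_partialDeriv, EuclideanSpace.real_norm_sq_eq]
  exact Finset.sum_mul_sq_le_sq_mul_sq _ _ _

lemma partialDeriv_sub {f g : Euc d → ℝ} (hf : ContDiff ℝ ∞ f) (hg : ContDiff ℝ ∞ g) (i : Fin d) :
    partialDeriv i (f - g) = partialDeriv i f - partialDeriv i g := by
  ext x
  simp [partialDeriv, fderiv_sub (hf.differentiable (by simp) x) (hg.differentiable (by simp) x)]

lemma eLpNorm_two_sq_eq_ofReal {α : Type*} [MeasurableSpace α] {μ : Measure α} {f : α → ℝ}
    (hf : MemLp f 2 μ) : eLpNorm f 2 μ ^ 2 = ENNReal.ofReal (∫ x, f x ^ 2 ∂μ) := by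
  rw [eLpNorm_two_sq, ofReal_integral_eq_lintegral_ofReal hf.integrable_sq
    (Eventually.of_forall fun x => sq_nonneg _)]
  refine lintegral_congr fun x => ?_
  rw [Real.enorm_eq_ofReal_abs, ← ENNReal.ofReal_pow (abs_nonneg _), sq_abs]

lemma tendsto_pow_nhds_zero_iff {κ : Type*} {l : Filter κ} {f : κ → ENNReal} {n : ℕ}
    (hn : n ≠ 0) : Tendsto (fun x => f x ^ n) l (𝓝 0) ↔ Tendsto f l (𝓝 0) := by
  refine ⟨fun h => ?_, fun h => by
    simpa [hn, Function.comp_def] using ((ENNReal.continuous_pow n).tendsto 0).comp h⟩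
  have hroot := (ENNReal.continuous_rpow_const (y := (n : ℝ)⁻¹)).tendsto 0 |>.comp h
  rw [ENNReal.zero_rpow_of_pos (by positivity)] at hroot
  exact hroot.congr fun x => ENNReal.pow_rpow_inv_natCast hn _

section SimplexTrace

variable {ι : Type*} (b : AffineBasis ι ℝ (Euc d))

section Finite

variable [Finite ι]

include b in
lemma exists_tendstoH1_simplex {v : Euc d → ℝ} (hv : MemH1 (interior (simplexBody b)) v) :
    ∃ ψ, TendstoH1 (interior (simplexBody b)) ψ v :=
  exists_tendstoH1 isOpen_interior (nonempty_interior_simplexBody b)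
    (isBounded_interior_simplexBody b) (convex_simplexBody b).interior hv

variable [Nontrivial ι]

/-- Apply `integral_simplexBody_radial` to `ψ ^ 2`, and bound `2 ψ ∇ψ·(x - b i)` by Cauchy–Schwarz
and the boundedness of the simplex. -/
lemma exists_integral_simplexFace_sq_le (i : ι) :
    ∃ C : ℝ, ∀ ψ : Euc d → ℝ, ContDiff ℝ 1 ψ →
      ∫ x in simplexFace b i, ψ x ^ 2 ∂(surf d) ≤
        C * ∫ x in simplexBody b, (ψ x ^ 2 + ∑ j, partialDeriv j ψ x ^ 2) := by
  obtain ⟨M, hM⟩ := (isCompact_simplexBody b).isBounded.subset_closedBall (b i)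
  refine ⟨‖altitude b i‖⁻¹ * (d + 1 + M ^ 2), fun ψ hψ => ?_⟩
  have hsq : ContDiff ℝ 1 fun x => ψ x ^ 2 := hψ.pow 2
  rw [mul_assoc, ← div_eq_inv_mul, le_div_iff₀' (norm_pos_iff.2 (altitude_ne_zero b i)),
    ← integral_simplexBody_radial b i hsq, ← integral_const_mul]
  have := hψ.continuous
  have := hψ.continuous_fderiv one_ne_zero
  have := hsq.continuous_fderiv one_ne_zero
  refine setIntegral_mono_on
    (ContinuousOn.integrableOn_compact (isCompact_simplexBody b)
      (Continuous.continuousOn (by fun_prop)))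
    (ContinuousOn.integrableOn_compact (isCompact_simplexBody b)
      (Continuous.continuousOn (by unfold partialDeriv; fun_prop)))
    (isClosed_simplexBody b).measurableSet fun x hx => ?_
  have hdist : ‖x - b i‖ ≤ M := by simpa [dist_eq_norm] using hM hx
  have hgrad : 0 ≤ ∑ j, partialDeriv j ψ x ^ 2 := Finset.sum_nonneg fun j _ => sq_nonneg _
  have hcauchySchwarz : (fderiv ℝ ψ x (x - b i)) ^ 2 ≤ M ^ 2 * ∑ j, partialDeriv j ψ x ^ 2 :=
    (sq_fderiv_le ψ x _).trans (by gcongr)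
  have hchain : fderiv ℝ (fun x => ψ x ^ 2) x (x - b i) = 2 * ψ x * fderiv ℝ ψ x (x - b i) := by
    rw [fderiv_fun_pow 2 (hψ.differentiable one_ne_zero x)]
    simp
  rw [hchain]
  nlinarith [sq_nonneg (ψ x - fderiv ℝ ψ x (x - b i)),
    mul_nonneg (Nat.cast_nonneg (α := ℝ) d) hgrad, mul_nonneg (sq_nonneg M) (sq_nonneg (ψ x))]

lemma exists_eLpNorm_simplexFace_le (i : ι) :
    ∃ C : ENNReal, C ≠ ⊤ ∧ ∀ ψ : Euc d → ℝ, ContDiff ℝ ∞ ψ →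
      eLpNorm ψ 2 ((surf d).restrict (simplexFace b i)) ^ 2 ≤
        C * (eLpNorm ψ 2 (volume.restrict (interior (simplexBody b))) ^ 2 +
          ∑ j, eLpNorm (partialDeriv j ψ) 2
            (volume.restrict (interior (simplexBody b))) ^ 2) := by
  obtain ⟨C, hC⟩ := exists_integral_simplexFace_sq_le b i
  refine ⟨ENNReal.ofReal C, by simp, fun ψ hψ => ?_⟩
  have hbounded := (isCompact_simplexBody b).isBounded
  have := isFiniteMeasure_restrict_volume hbounded
  have hval : MemLp ψ 2 (volume.restrict (simplexBody b)) :=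
    memLp_of_continuous_of_isBounded hbounded hψ.continuous
  have hgrad : ∀ j, MemLp (partialDeriv j ψ) 2 (volume.restrict (simplexBody b)) := fun j =>
    memLp_of_continuous_of_isBounded hbounded (continuous_partialDeriv hψ j)
  have hface : MemLp ψ 2 ((surf d).restrict (simplexFace b i)) :=
    memLp_of_continuous_of_isBounded (isCompact_simplexFace b i).isBounded hψ.continuous
  rw [restrict_interior_simplexBody, eLpNorm_two_sq_eq_ofReal hval, eLpNorm_two_sq_eq_ofReal hface]
  simp_rw [fun j => eLpNorm_two_sq_eq_ofReal (hgrad j)]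
  rw [← ENNReal.ofReal_sum_of_nonneg fun j _ => integral_nonneg fun x => sq_nonneg _,
    ← ENNReal.ofReal_add (integral_nonneg fun x => sq_nonneg _)
      (Finset.sum_nonneg fun j _ => integral_nonneg fun x => sq_nonneg _),
    ← integral_finsetSum _ fun j _ => (hgrad j).integrable_sq,
    ← integral_add hval.integrable_sq (integrable_finsetSum _ fun j _ => (hgrad j).integrable_sq),
    ← ENNReal.ofReal_mul' (integral_nonneg fun x => by positivity)]
  exact ENNReal.ofReal_le_ofReal (hC ψ (hψ.of_le (by simp)))

lemma tendsto_eLpNorm_simplexFace (i : ι) {κ : Type*} {l : Filter κ}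
    {ψ : κ → Euc d → ℝ} (hψ : ∀ n, ContDiff ℝ ∞ (ψ n))
    (hval : Tendsto (fun n => eLpNorm (ψ n) 2 (volume.restrict (interior (simplexBody b)))) l
      (𝓝 0))
    (hgrad : ∀ j, Tendsto (fun n => eLpNorm (partialDeriv j (ψ n)) 2
      (volume.restrict (interior (simplexBody b)))) l (𝓝 0)) :
    Tendsto (fun n => eLpNorm (ψ n) 2 ((surf d).restrict (simplexFace b i))) l (𝓝 0) := by
  obtain ⟨C, hC, htrace⟩ := exists_eLpNorm_simplexFace_le b i
  rw [← tendsto_pow_nhds_zero_iff two_ne_zero]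
  have hbound := ENNReal.Tendsto.const_mul
    (((tendsto_pow_nhds_zero_iff two_ne_zero).2 hval).add (tendsto_finsetSum Finset.univ fun j _ =>
      (tendsto_pow_nhds_zero_iff two_ne_zero).2 (hgrad j))) (Or.inr hC)
  simp only [Finset.sum_const_zero, add_zero, mul_zero] at hbound
  exact tendsto_of_tendsto_of_tendsto_of_le_of_le tendsto_const_nhds hbound (fun _ => bot_le)
    fun n => htrace _ (hψ n)

variable {v g g' : Euc d → ℝ}

lemma exists_hasTrace_simplexFace (i : ι) (hv : MemH1 (interior (simplexBody b)) v) :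
    ∃ g, HasTrace (interior (simplexBody b)) (simplexFace b i) v g := by
  obtain ⟨ψ, hψ⟩ := exists_tendstoH1_simplex b hv
  have hface : ∀ n, MemLp (ψ n) 2 ((surf d).restrict (simplexFace b i)) := fun n =>
    memLp_of_continuous_of_isBounded (isCompact_simplexFace b i).isBounded
      (hψ.smooth n).continuous
  have hval := tendsto_eLpNorm_sub_of_tendsto one_le_two
    (fun n => (hψ.smooth n).continuous.aestronglyMeasurable) hv.1.1 hψ.val
  have hgrad : ∀ j, Tendsto (fun m : ℕ × ℕ => eLpNorm (partialDeriv j (ψ m.1 - ψ m.2)) 2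
      (volume.restrict (interior (simplexBody b)))) atTop (𝓝 0) := fun j => by
    simp_rw [fun m : ℕ × ℕ => partialDeriv_sub (hψ.smooth m.1) (hψ.smooth m.2) j]
    exact tendsto_eLpNorm_sub_of_tendsto (f := fun n => partialDeriv j (ψ n)) one_le_two
      (fun n => (continuous_partialDeriv (hψ.smooth n) j).aestronglyMeasurable)
      (hv.memL2_weakPartial j).1 (hψ.grad j)
  obtain ⟨g, hg, hgl⟩ := exists_tendsto_eLpNorm_of_cauchy hface (tendsto_eLpNorm_simplexFace b i
    (fun m : ℕ × ℕ => (hψ.smooth m.1).sub (hψ.smooth m.2)) hval hgrad)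
  exact ⟨g, hasTrace_iff.2 ⟨hv, hg, ψ, hψ, hgl⟩⟩

variable {b}

lemma HasTrace.tendsto_of_tendstoH1 {i : ι}
    (h : HasTrace (interior (simplexBody b)) (simplexFace b i) v g) {ψ : ℕ → Euc d → ℝ}
    (hψ : TendstoH1 (interior (simplexBody b)) ψ v) :
    Tendsto (fun n => eLpNorm (ψ n - g) 2 ((surf d).restrict (simplexFace b i))) atTop (𝓝 0) := by
  obtain ⟨hv, hg, χ, hχ, hχg⟩ := hasTrace_iff.1 h
  have hval : Tendsto (fun n => eLpNorm (ψ n - χ n) 2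
      (volume.restrict (interior (simplexBody b)))) atTop (𝓝 0) := by
    simpa using tendsto_eLpNorm_sub_sub one_le_two
      (fun n => (hψ.smooth n).continuous.aestronglyMeasurable)
      (fun n => (hχ.smooth n).continuous.aestronglyMeasurable) hv.1.1 hv.1.1 hψ.val hχ.val
  have hgrad : ∀ j, Tendsto (fun n => eLpNorm (partialDeriv j (ψ n - χ n)) 2
      (volume.restrict (interior (simplexBody b)))) atTop (𝓝 0) := fun j => by
    simp_rw [fun n => partialDeriv_sub (hψ.smooth n) (hχ.smooth n) j]
    simpa using tendsto_eLpNorm_sub_sub one_le_two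
      (fun n => (continuous_partialDeriv (hψ.smooth n) j).aestronglyMeasurable)
      (fun n => (continuous_partialDeriv (hχ.smooth n) j).aestronglyMeasurable)
      (hv.memL2_weakPartial j).1 (hv.memL2_weakPartial j).1 (hψ.grad j) (hχ.grad j)
  have hdiff := tendsto_eLpNorm_simplexFace b i
    (fun n => (hψ.smooth n).sub (hχ.smooth n)) hval hgrad
  refine tendsto_of_tendsto_of_tendsto_of_le_of_le tendsto_const_nhds
    (by simpa using hdiff.add hχg) (fun _ => bot_le) fun n => ?_
  rw [← sub_add_sub_cancel (ψ n) (χ n) g]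
  exact eLpNorm_add_le ((hψ.smooth n).sub (hχ.smooth n)).continuous.aestronglyMeasurable
    ((hχ.smooth n).continuous.aestronglyMeasurable.sub hg.1) one_le_two

lemma HasTrace.ae_unique {i : ι} (h : HasTrace (interior (simplexBody b)) (simplexFace b i) v g)
    (h' : HasTrace (interior (simplexBody b)) (simplexFace b i) v g') :
    g =ᵐ[(surf d).restrict (simplexFace b i)] g' := by
  obtain ⟨-, hg, ψ, hψ, hψg⟩ := hasTrace_iff.1 h
  exact ae_eq_of_tendsto_eLpNorm_sub one_le_two
    (fun n => (hψ.smooth n).continuous.aestronglyMeasurable) hg.1 h'.2.1.1 hψg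
    (h'.tendsto_of_tendstoH1 hψ)

end Finite

variable [Fintype ι] [Nontrivial ι] {v w : Euc d → ℝ}

lemma integral_simplexBody_by_parts_of_contDiff {ψ χ : Euc d → ℝ} (hψ : ContDiff ℝ ∞ ψ)
    (hχ : ContDiff ℝ ∞ χ) (k : Fin d) :
    (∫ x in interior (simplexBody b), ψ x * partialDeriv k χ x) +
        (∫ x in interior (simplexBody b), χ x * partialDeriv k ψ x) =
      ∑ i, faceNormal b i k * ∫ x in simplexFace b i, ψ x * χ x ∂(surf d) := by
  have hintegrable {f : Euc d → ℝ} (hf : Continuous f) : IntegrableOn f (simplexBody b) :=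
    hf.continuousOn.integrableOn_compact (isCompact_simplexBody b)
  have hdiv := integral_simplexBody_fderiv b ((hψ.mul hχ).of_le (m := 1) (by simp))
    (EuclideanSpace.single k (1 : ℝ))
  rw [restrict_interior_simplexBody,
    ← integral_add (f := fun x => ψ x * partialDeriv k χ x) (g := fun x => χ x * partialDeriv k ψ x)
      (hintegrable (hψ.continuous.mul (continuous_partialDeriv hχ k)))
      (hintegrable (hχ.continuous.mul (continuous_partialDeriv hψ k)))]
  simp_rw [← partialDeriv_mul hψ hχ k]
  simpa [partialDeriv, EuclideanSpace.inner_single_right] using hdiv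

lemma integral_simplexBody_by_parts {gv gw : ι → Euc d → ℝ}
    (hv : MemH1 (interior (simplexBody b)) v) (hw : MemH1 (interior (simplexBody b)) w)
    (hgv : ∀ i, HasTrace (interior (simplexBody b)) (simplexFace b i) v (gv i))
    (hgw : ∀ i, HasTrace (interior (simplexBody b)) (simplexFace b i) w (gw i)) (k : Fin d) :
    (∫ x in interior (simplexBody b), v x * weakPartial (interior (simplexBody b)) k w x) +
        (∫ x in interior (simplexBody b), w x * weakPartial (interior (simplexBody b)) k v x) =
      ∑ i, faceNormal b i k * ∫ x in simplexFace b i, gv i x * gw i x ∂(surf d) := by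
  obtain ⟨ψ, hψ⟩ := exists_tendstoH1_simplex b hv
  obtain ⟨χ, hχ⟩ := exists_tendstoH1_simplex b hw
  have hbounded := isBounded_interior_simplexBody b
  have := isFiniteMeasure_restrict_volume hbounded
  have hL2 {f : Euc d → ℝ} (hf : Continuous f) :
      MemLp f 2 (volume.restrict (interior (simplexBody b))) :=
    memLp_of_continuous_of_isBounded hbounded hf
  have hL2face {f : Euc d → ℝ} (hf : Continuous f) (i : ι) :
      MemLp f 2 ((surf d).restrict (simplexFace b i)) :=
    memLp_of_continuous_of_isBounded (isCompact_simplexFace b i).isBounded hf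
  have hψc := fun n => (hψ.smooth n).continuous
  have hχc := fun n => (hχ.smooth n).continuous
  have hlhs := (tendsto_integral_mul_of_tendsto_eLpNorm (fun n => hL2 (hψc n))
      (fun n => hL2 (continuous_partialDeriv (hχ.smooth n) k)) hv.1 (hw.memL2_weakPartial k)
      hψ.val (hχ.grad k)).add
    (tendsto_integral_mul_of_tendsto_eLpNorm (fun n => hL2 (hχc n))
      (fun n => hL2 (continuous_partialDeriv (hψ.smooth n) k)) hw.1 (hv.memL2_weakPartial k)
      hχ.val (hψ.grad k))
  have hrhs := tendsto_finsetSum Finset.univ fun i _ =>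
    (tendsto_integral_mul_of_tendsto_eLpNorm (fun n => hL2face (hψc n) i)
      (fun n => hL2face (hχc n) i) (hgv i).2.1 (hgw i).2.1 ((hgv i).tendsto_of_tendstoH1 hψ)
      ((hgw i).tendsto_of_tendstoH1 hχ)).const_mul (faceNormal b i k)
  exact tendsto_nhds_unique (hlhs.congr fun n =>
    integral_simplexBody_by_parts_of_contDiff b (hψ.smooth n) (hχ.smooth n) k) hrhs

end SimplexTrace

/-! ### Facets of a triangulation near their generic points -/

section FacePoint

variable {ι : Type*} {b : AffineBasis ι ℝ (Euc d)} {i : ι} {x : Euc d}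

/-- A point in the relative interior of the face of `simplexBody b` opposite to the vertex `b i`:
it lies on no other face, so that near it the simplex is a half-space. -/
def IsFacePoint (b : AffineBasis ι ℝ (Euc d)) (i : ι) (x : Euc d) : Prop :=
  b.coord i x = 0 ∧ ∀ j, j ≠ i → 0 < b.coord j x

lemma IsFacePoint.mem_simplexFace (h : IsFacePoint b i x) : x ∈ simplexFace b i := by
  refine ⟨fun j => ?_, h.1⟩
  obtain rfl | hj := eq_or_ne j i
  · exact h.1.ge
  · exact (h.2 j hj).le

lemma IsFacePoint.eventually_mem_simplexBody [Finite ι] (h : IsFacePoint b i x) :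
    ∀ᶠ y in 𝓝 x, y ∈ simplexBody b ↔ 0 ≤ b.coord i y := by
  have hpos : ∀ᶠ y in 𝓝 x, ∀ j, j ≠ i → 0 < b.coord j y := by
    refine eventually_all.2 fun j => ?_
    obtain rfl | hj := eq_or_ne j i
    · exact .of_forall fun y hj => absurd rfl hj
    · filter_upwards [(continuous_barycentric_coord b j).continuousAt.eventually
        (lt_mem_nhds (h.2 j hj))] with y hy _ using hy
  filter_upwards [hpos] with y hy
  refine ⟨fun hyb => hyb i, fun hyi j => ?_⟩
  obtain rfl | hj := eq_or_ne j i
  · exact hyi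
  · exact (hy j hj).le

lemma IsFacePoint.simplexFace_subset_closure (h : IsFacePoint b i x) :
    simplexFace b i ⊆ closure {y | IsFacePoint b i y} := by
  intro y hy
  have hlim : Tendsto (fun τ : ℝ => AffineMap.lineMap y x τ) (𝓝[>] 0) (𝓝 y) :=
    (AffineMap.lineMap_continuous.tendsto' _ _ (AffineMap.lineMap_apply_zero y x)).mono_left
      nhdsWithin_le_nhds
  refine mem_closure_of_tendsto hlim ?_
  filter_upwards [Ioo_mem_nhdsGT (zero_lt_one' ℝ)] with τ hτ
  refine ⟨?_, fun j hj => ?_⟩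
  · rw [AffineMap.apply_lineMap, h.1, hy.2, AffineMap.lineMap_same_apply]
  · rw [AffineMap.apply_lineMap, AffineMap.lineMap_apply_ring]
    exact add_pos_of_nonneg_of_pos (mul_nonneg (sub_nonneg.2 hτ.2.le) (hy.1 j))
      (mul_pos hτ.1 (h.2 j hj))

lemma frequently_coord_lt [Nontrivial ι] (b : AffineBasis ι ℝ (Euc d)) (i : ι) (y : Euc d) :
    ∃ᶠ z in 𝓝 y, b.coord i y < b.coord i z :=
  ((frequently_gt_nhds (b.coord i y)).filter_mono ((isOpenMap_barycentric_coord b i).nhds_le y) :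
    ∃ᶠ r in map (b.coord i) (𝓝 y), b.coord i y < r)

lemma eventually_coord_nonneg_iff [Nontrivial ι] (b : AffineBasis ι ℝ (Euc d)) (i : ι)
    (y : Euc d) : (∀ᶠ z in 𝓝 y, 0 ≤ b.coord i z) ↔ 0 < b.coord i y := by
  have hpre := (isOpenMap_barycentric_coord b i).preimage_interior_eq_interior_preimage
    (continuous_barycentric_coord b i) (Ici 0)
  rw [interior_Ici] at hpre
  exact mem_interior_iff_mem_nhds.symm.trans (Set.ext_iff.1 hpre y).symm

lemma affineMap_apply_eq_sum_coord_mul [Fintype ι] (b : AffineBasis ι ℝ (Euc d))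
    (f : Euc d →ᵃ[ℝ] ℝ) (y : Euc d) : f y = ∑ j, b.coord j y * f (b j) := by
  have hsum := b.sum_coord_apply_eq_one y
  conv_lhs => rw [← b.affineCombination_coord_eq_self y]
  rw [Finset.map_affineCombination _ _ _ hsum,
    Finset.affineCombination_eq_linear_combination _ _ _ hsum]
  rfl

lemma coord_eq_mul_coord_of_forall_ne {ι' : Type*} [Finite ι] (b : AffineBasis ι ℝ (Euc d))
    (b' : AffineBasis ι' ℝ (Euc d)) {i : ι} {i' : ι'} (h : ∀ j, j ≠ i → b'.coord i' (b j) = 0)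
    (y : Euc d) : b'.coord i' y = b'.coord i' (b i) * b.coord i y := by
  cases nonempty_fintype ι
  rw [affineMap_apply_eq_sum_coord_mul b, Finset.sum_eq_single i, mul_comm]
  · intro j _ hj
    rw [h j hj, mul_zero]
  · exact fun hi => absurd (Finset.mem_univ i) hi

lemma faceNormal_eq_neg {ι' : Type*} {b' : AffineBasis ι' ℝ (Euc d)} {i' : ι'} {c : ℝ} (hc : c < 0)
    (h : ∀ y, b'.coord i' y = c * b.coord i y) : faceNormal b' i' = -faceNormal b i := by
  have hgrad : coordGrad b' i' = c • coordGrad b i := by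
    refine ext_inner_right ℝ fun y => ?_
    have hadd := h (0 + y)
    rw [coord_add, coord_add, h 0, mul_add] at hadd
    rw [real_inner_smul_left]
    exact add_left_cancel hadd
  rw [faceNormal, faceNormal, hgrad, norm_smul, Real.norm_eq_abs, abs_of_neg hc, smul_smul,
    mul_inv, mul_right_comm, inv_neg, neg_mul, inv_mul_cancel₀ hc.ne, neg_one_mul, neg_smul]

end FacePoint

section OuterNormal

variable {Ω : Set (Euc d)} {x ν ν' : Euc d}

lemma IsOuterNormal.eventually_add_smul_mem_iff (h : IsOuterNormal Ω x ν) (w : Euc d) :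
    ∀ᶠ τ : ℝ in 𝓝[>] 0, x + τ • w ∈ Ω ↔ inner ℝ w ν < 0 := by
  obtain ⟨-, ε, hε, hball⟩ := h
  have hlim : Tendsto (fun τ : ℝ => x + τ • w) (𝓝[>] 0) (𝓝 x) :=
    (Continuous.tendsto' (by fun_prop) 0 x (by simp)).mono_left nhdsWithin_le_nhds
  filter_upwards [hlim.eventually (Metric.ball_mem_nhds x hε), self_mem_nhdsWithin] with τ hτ hpos
  rw [hball _ hτ, add_sub_cancel_left, real_inner_smul_left, ← smul_eq_mul,
    smul_neg_iff_of_pos_left hpos]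

lemma IsOuterNormal.unique (h : IsOuterNormal Ω x ν) (h' : IsOuterNormal Ω x ν') : ν = ν' := by
  have hiff : inner ℝ (ν - ν') ν < 0 ↔ inner ℝ (ν - ν') ν' < 0 := by
    obtain ⟨τ, hτ, hτ'⟩ := ((h.eventually_add_smul_mem_iff (ν - ν')).and
      (h'.eventually_add_smul_mem_iff (ν - ν'))).exists
    exact hτ.symm.trans hτ'
  rw [inner_sub_left, inner_sub_left, real_inner_self_eq_norm_sq, real_inner_self_eq_norm_sq,
    h.1, h'.1, real_inner_comm] at hiff
  refine (inner_eq_one_iff_of_norm_eq_one h.1 h'.1).1 (le_antisymm (?_ : _ ≤ (1 : ℝ)) ?_)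
  · simpa only [h.1, h'.1, mul_one] using real_inner_le_norm ν ν'
  · by_contra! hlt
    linarith [hiff.2 (by linarith)]

lemma IsOuterNormal.outerNormal_eq (h : IsOuterNormal Ω x ν) : outerNormal Ω x = ν := by
  have hex : ∃ ν, IsOuterNormal Ω x ν := ⟨ν, h⟩
  rw [outerNormal, dif_pos hex]
  exact hex.choose_spec.unique h

end OuterNormal

lemma exists_erase_eq_erase {α : Type*} [DecidableEq α] {s t : Finset α} {p : α}
    (hcard : t.card = s.card) (hne : t ≠ s) (hp : p ∈ s) (hsub : s.erase p ⊆ t) :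
    p ∉ t ∧ ∃ q ∈ t, t.erase q = s.erase p := by
  have hpt : p ∉ t := fun hpt =>
    hne (Finset.eq_of_subset_of_card_le (Finset.insert_erase hp ▸ Finset.insert_subset hpt hsub)
      hcard.le).symm
  obtain ⟨q, hq, hqt⟩ := Finset.exists_eq_insert_iff.2
    ⟨hsub, by rw [Finset.card_erase_add_one hp, hcard]⟩
  exact ⟨hpt, q, hqt ▸ Finset.mem_insert_self q _, by rw [← hqt, Finset.erase_insert hq]⟩

namespace Triangulation

variable {Ω : Set (Euc d)} (T : Triangulation Ω)

/-- The affine basis formed by the vertices of an element, indexed by the vertices themselves. -/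
def basis (s : T.elements) : AffineBasis s.1 ℝ (Euc d) where
  toFun := Subtype.val
  ind' := T.complex.indep s.2.1
  tot' := by
    refine (T.complex.indep s.2.1).affineSpan_eq_top_iff_card_eq_finrank_add_one.2 ?_
    rw [Fintype.card_coe, s.2.2, finrank_euclideanSpace, Fintype.card_fin]

instance nontrivial_element [NeZero d] (s : T.elements) : Nontrivial s.1 := by
  rw [← Fintype.one_lt_card_iff_nontrivial, Fintype.card_coe, s.2.2, Nat.lt_add_left_iff_pos]
  exact NeZero.pos d

instance finite_elements : Finite T.elements :=
  T.finite.subset fun _ hs => hs.1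

lemma simplexBody_basis (s : T.elements) :
    simplexBody (T.basis s) = convexHull ℝ (s.1 : Set (Euc d)) := by
  rw [simplexBody_eq_convexHull]
  exact congrArg _ Subtype.range_coe

lemma coord_eq_zero_of_mem_convexHull (s : T.elements) (p : s.1) {A : Set (Euc d)}
    (hA : A ⊆ s.1) (hp : (p : Euc d) ∉ A) {x : Euc d} (hx : x ∈ convexHull ℝ A) :
    (T.basis s).coord p x = 0 := by
  refine convexHull_min (t := (T.basis s).coord p ⁻¹' {0}) (fun q hq => ?_)
    ((convex_singleton 0).affine_preimage _) hx
  exact (T.basis s).coord_apply_ne (j := ⟨q, hA hq⟩) fun hpq => hp (by rwa [hpq])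

lemma simplexFace_basis (s : T.elements) (p : s.1) :
    simplexFace (T.basis s) p = convexHull ℝ ((s.1 : Set (Euc d)) \ {(p : Euc d)}) := by
  refine Subset.antisymm ?_ fun x hx => ⟨?_, ?_⟩
  · rintro x ⟨hx, hxp⟩
    have hpoint := (T.basis s).linear_combination_coord_eq_self x
    have hsum := (T.basis s).sum_coord_apply_eq_one x
    rw [← Finset.sum_erase (a := p) _ (by rw [hxp, zero_smul])] at hpoint
    rw [← Finset.sum_erase (a := p) _ hxp] at hsum
    rw [← hpoint]
    refine (convex_convexHull ℝ _).sum_mem (fun q _ => hx q) hsum fun q hq => ?_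
    exact subset_convexHull ℝ _ ⟨q.2, fun hqp => (Finset.mem_erase.1 hq).1 (Subtype.ext hqp)⟩
  · rw [simplexBody_basis]
    exact convexHull_mono sdiff_subset hx
  · exact T.coord_eq_zero_of_mem_convexHull s p sdiff_subset (by simp) hx

lemma closure_eq_iUnion : closure Ω = ⋃ s : T.elements, simplexBody (T.basis s) := by
  rw [← T.space_eq]
  ext x
  rw [Geometry.SimplicialComplex.mem_space_iff, mem_iUnion]
  simp_rw [simplexBody_basis]
  constructor
  · rintro ⟨s, hs, hx⟩
    obtain ⟨t, ht, hst, hcard⟩ := T.pure s hs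
    exact ⟨⟨t, ht, hcard⟩, convexHull_mono (Finset.coe_subset.2 hst) hx⟩
  · rintro ⟨s, hx⟩
    exact ⟨s, s.2.1, hx⟩

lemma simplexBody_subset_closure (s : T.elements) : simplexBody (T.basis s) ⊆ closure Ω := by
  rw [T.closure_eq_iUnion]
  exact subset_iUnion (fun s => simplexBody (T.basis s)) s

lemma interior_simplexBody_subset (hΩ : interior (closure Ω) = Ω) (s : T.elements) :
    interior (simplexBody (T.basis s)) ⊆ Ω :=
  (interior_mono (T.simplexBody_subset_closure s)).trans hΩ.subset

lemma mem_convexHull_inter {s t : T.elements} {x : Euc d} (hs : x ∈ simplexBody (T.basis s))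
    (ht : x ∈ simplexBody (T.basis t)) : x ∈ convexHull ℝ (s.1 ∩ t.1 : Set (Euc d)) := by
  rw [simplexBody_basis] at hs ht
  exact T.complex.inter_subset_convexHull s.2.1 t.2.1 ⟨hs, ht⟩

end Triangulation

section Opposite

variable {Ω : Set (Euc d)} {T : Triangulation Ω} {s t u : T.elements} {p : s.1} {x : Euc d}

lemma IsFacePoint.erase_subset [DecidableEq (Euc d)] (h : IsFacePoint (T.basis s) p x)
    (hx : x ∈ simplexBody (T.basis t)) : s.1.erase p ⊆ t.1 := by
  intro q hq
  obtain ⟨hqp, hqs⟩ := Finset.mem_erase.1 hq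
  by_contra hqt
  refine (h.2 ⟨q, hqs⟩ fun hqp' => hqp (congrArg Subtype.val hqp')).ne' ?_
  exact T.coord_eq_zero_of_mem_convexHull s _ inter_subset_left (fun hqst => hqt hqst.2)
    (T.mem_convexHull_inter h.mem_simplexFace.1 hx)

lemma IsFacePoint.of_erase_eq [DecidableEq (Euc d)] {q : t.1}
    (h : IsFacePoint (T.basis s) p x) (he : t.1.erase q = s.1.erase p) :
    IsFacePoint (T.basis t) q x := by
  have hface : simplexFace (T.basis t) q = simplexFace (T.basis s) p := by
    simp_rw [T.simplexFace_basis, ← Finset.coe_erase, he]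
  refine ⟨(hface ▸ h.mem_simplexFace).2, fun r hr => ?_⟩
  have hmem : ∀ {r}, r ∈ t.1.erase q ↔ r ∈ s.1.erase p := fun {r} => he ▸ Iff.rfl
  have hrs := Finset.mem_erase.1 (hmem.1 (Finset.mem_erase.2 ⟨Subtype.coe_ne_coe.2 hr, r.2⟩))
  rw [affineMap_apply_eq_sum_coord_mul (T.basis s)]
  refine Finset.sum_pos' (fun v _ => ?_) ⟨⟨r, hrs.2⟩, Finset.mem_univ _, ?_⟩
  · obtain rfl | hv := eq_or_ne v p
    · rw [h.1, zero_mul]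
    · have hvt := Finset.mem_erase.1 (hmem.2 (Finset.mem_erase.2 ⟨Subtype.coe_ne_coe.2 hv, v.2⟩))
      exact mul_nonneg (h.2 v hv).le (coord_vertex_nonneg (T.basis t) ⟨v, hvt.2⟩ r)
  · have hone : (T.basis t).coord r (T.basis s ⟨r, hrs.2⟩) = 1 := (T.basis t).coord_apply_eq r
    rw [hone, mul_one]
    exact h.2 _ fun hrp => hrs.1 (congrArg Subtype.val hrp)

lemma coord_eq_mul_coord_of_erase_eq [DecidableEq (Euc d)] {q : t.1}
    (he : t.1.erase q = s.1.erase p) (y : Euc d) :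
    (T.basis t).coord q y = (T.basis t).coord q p * (T.basis s).coord p y := by
  refine coord_eq_mul_coord_of_forall_ne (T.basis s) (T.basis t) (fun r hr => ?_) y
  have hrt : (r : Euc d) ∈ t.1.erase q := by
    rw [he]
    exact Finset.mem_erase.2 ⟨Subtype.coe_ne_coe.2 hr, r.2⟩
  obtain ⟨hrq, hrt⟩ := Finset.mem_erase.1 hrt
  exact (T.basis t).coord_apply_ne (j := ⟨r, hrt⟩) fun hqr => hrq (congrArg Subtype.val hqr).symm

variable [NeZero d]

lemma IsFacePoint.exists_opposite (h : IsFacePoint (T.basis s) p x)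
    (hx : x ∈ simplexBody (T.basis t)) (hts : t ≠ s) :
    ∃ q, IsFacePoint (T.basis t) q x ∧
      ∃ c < 0, ∀ y, (T.basis t).coord q y = c * (T.basis s).coord p y := by
  classical
  obtain ⟨hpt, q, hq, he⟩ := exists_erase_eq_erase (t.2.2.trans s.2.2.symm)
    (Subtype.coe_ne_coe.2 hts) p.2 (h.erase_subset hx)
  have hcoord := coord_eq_mul_coord_of_erase_eq (T := T) (q := ⟨q, hq⟩) he
  have hxt : IsFacePoint (T.basis t) ⟨q, hq⟩ x := h.of_erase_eq he
  refine ⟨⟨q, hq⟩, hxt, _, ?_, hcoord⟩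
  by_contra! hc
  -- Otherwise the two simplices overlap on the positive side of the common face.
  obtain ⟨z, hz, hzs, hzt⟩ := ((frequently_coord_lt (T.basis s) p x).and_eventually
    (h.eventually_mem_simplexBody.and hxt.eventually_mem_simplexBody)).exists
  rw [h.1] at hz
  refine hz.ne' (T.coord_eq_zero_of_mem_convexHull s p inter_subset_left (fun hp => hpt hp.2)
    (T.mem_convexHull_inter (hzs.2 hz.le) (hzt.2 ?_)))
  rw [hcoord]
  exact mul_nonneg hc hz.le

lemma IsFacePoint.mem_of_mem_simplexBody (hΩ : interior (closure Ω) = Ω)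
    (h : IsFacePoint (T.basis s) p x) (hx : x ∈ simplexBody (T.basis t)) (hts : t ≠ s) :
    x ∈ Ω := by
  obtain ⟨q, hq, c, hc, hcoord⟩ := h.exists_opposite hx hts
  rw [← hΩ, mem_interior_iff_mem_nhds]
  filter_upwards [h.eventually_mem_simplexBody, hq.eventually_mem_simplexBody] with y hys hyt
  rcases le_total 0 ((T.basis s).coord p y) with hnonneg | hnonpos
  · exact T.simplexBody_subset_closure s (hys.2 hnonneg)
  · refine T.simplexBody_subset_closure t (hyt.2 ?_)
    rw [hcoord]
    exact mul_nonneg_of_nonpos_of_nonpos hc.le hnonpos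

lemma IsFacePoint.eq_of_mem_simplexBody (h : IsFacePoint (T.basis s) p x)
    (hxt : x ∈ simplexBody (T.basis t)) (hts : t ≠ s)
    (hxu : x ∈ simplexBody (T.basis u)) (hus : u ≠ s) : u = t := by
  by_contra hut
  obtain ⟨q, hq, c, hc, hcoord⟩ := h.exists_opposite hxt hts
  obtain ⟨r, hr, c', hc', hcoord'⟩ := h.exists_opposite hxu hus
  obtain ⟨r', hr', c'', hc'', hcoord''⟩ := hq.exists_opposite hxu hut
  obtain rfl : r' = r := by
    by_contra hne
    exact (hr.2 r' hne).ne' hr'.1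
  have hsign : c' = c'' * c := by
    have hp := hcoord' (T.basis s p)
    rwa [hcoord'', hcoord, (T.basis s).coord_apply_eq, mul_one, mul_one, eq_comm] at hp
  exact (mul_pos_of_neg_of_neg hc'' hc).not_gt (hsign ▸ hc')

lemma IsFacePoint.eventually_mem_iff (hΩ : interior (closure Ω) = Ω)
    (h : IsFacePoint (T.basis s) p x)
    (huniq : ∀ t : T.elements, x ∈ simplexBody (T.basis t) → t = s) :
    ∀ᶠ y in 𝓝 x, y ∈ Ω ↔ 0 < (T.basis s).coord p y := by
  have hother : ∀ᶠ y in 𝓝 x, ∀ t : T.elements, t ≠ s → y ∉ simplexBody (T.basis t) := by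
    refine eventually_all.2 fun t => ?_
    by_cases hts : t = s
    · exact .of_forall fun y hne => absurd hts hne
    · filter_upwards [(isClosed_simplexBody (T.basis t)).compl_mem_nhds
        fun hx => hts (huniq t hx)] with y hy _ using hy
  have hclosure : ∀ᶠ y in 𝓝 x, y ∈ closure Ω ↔ 0 ≤ (T.basis s).coord p y := by
    filter_upwards [hother, h.eventually_mem_simplexBody] with y hy hys
    rw [← hys, T.closure_eq_iUnion, mem_iUnion]
    refine ⟨fun ⟨t, ht⟩ => ?_, fun hs => ⟨s, hs⟩⟩
    obtain rfl : t = s := not_not.1 fun hts => hy t hts ht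
    exact ht
  filter_upwards [hclosure.eventually_nhds] with y hy
  calc y ∈ Ω ↔ y ∈ interior (closure Ω) := by rw [hΩ]
    _ ↔ ∀ᶠ z in 𝓝 y, 0 ≤ (T.basis s).coord p z :=
      mem_interior_iff_mem_nhds.trans (Filter.eventually_congr hy)
    _ ↔ 0 < (T.basis s).coord p y := eventually_coord_nonneg_iff _ _ _

lemma IsFacePoint.isOuterNormal (hΩ : interior (closure Ω) = Ω)
    (h : IsFacePoint (T.basis s) p x)
    (huniq : ∀ t : T.elements, x ∈ simplexBody (T.basis t) → t = s) :
    IsOuterNormal Ω x (faceNormal (T.basis s) p) := by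
  refine ⟨norm_faceNormal _ p, ?_⟩
  obtain ⟨ε, hε, hball⟩ := Metric.eventually_nhds_iff_ball.1 (h.eventually_mem_iff hΩ huniq)
  refine ⟨ε, hε, fun y hy => ?_⟩
  rw [hball y hy, coord_eq_add_inner_sub _ p x y, h.1, zero_add, coordGrad_eq_smul_faceNormal,
    real_inner_smul_left, real_inner_comm, neg_mul, neg_pos, ← smul_eq_mul,
    smul_neg_iff_of_pos_left (norm_pos_iff.2 (coordGrad_ne_zero _ p))]

lemma IsFacePoint.notMem_iff (hΩ : interior (closure Ω) = Ω) (h : IsFacePoint (T.basis s) p x) :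
    x ∉ Ω ↔ ∀ t : T.elements, x ∈ simplexBody (T.basis t) → t = s := by
  refine ⟨fun hx t ht => not_not.1 fun hts => hx (h.mem_of_mem_simplexBody hΩ ht hts),
    fun huniq => ?_⟩
  rw [(h.eventually_mem_iff hΩ huniq).self_of_nhds, h.1]
  exact lt_irrefl 0

lemma IsFacePoint.simplexFace_subset_frontier (hΩ : interior (closure Ω) = Ω)
    (h : IsFacePoint (T.basis s) p x) (hx : x ∉ Ω) :
    simplexFace (T.basis s) p ⊆ frontier Ω := by
  classical
  refine h.simplexFace_subset_closure.trans (closure_minimal (fun y hy => ?_) isClosed_frontier)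
  have hopen : IsOpen Ω := hΩ ▸ isOpen_interior
  rw [hopen.frontier_eq]
  refine ⟨T.simplexBody_subset_closure s hy.mem_simplexFace.1, (hy.notMem_iff hΩ).2 fun t ht => ?_⟩
  refine (h.notMem_iff hΩ).1 hx t ?_
  have hxface := h.mem_simplexFace
  rw [T.simplexFace_basis, ← Finset.coe_erase] at hxface
  rw [T.simplexBody_basis]
  exact convexHull_mono (Finset.coe_subset.2 (hy.erase_subset ht)) hxface

end Opposite

/-! ### Green's formula on a triangulated domain -/

section Elements

variable {Ω : Set (Euc d)}

lemma notMem_of_mem_frontier (hΩ : interior (closure Ω) = Ω) {x : Euc d} (hx : x ∈ frontier Ω) :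
    x ∉ Ω :=
  (disjoint_frontier_iff_isOpen.2 (hΩ ▸ isOpen_interior)).notMem_of_mem_left hx

namespace Triangulation

instance fintypeElements (T : Triangulation Ω) : Fintype T.elements := Fintype.ofFinite _

lemma isBounded_domain (T : Triangulation Ω) : Bornology.IsBounded Ω := by
  refine Bornology.IsBounded.subset ?_ subset_closure
  rw [T.closure_eq_iUnion]
  exact Bornology.isBounded_iUnion.2 fun s => (isCompact_simplexBody _).isBounded

lemma disjoint_interior_simplexBody {T : Triangulation Ω} {s t : T.elements} (hst : s ≠ t) :
    Disjoint (interior (simplexBody (T.basis s))) (interior (simplexBody (T.basis t))) := by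
  refine Set.disjoint_left.2 fun x hs ht => ?_
  obtain ⟨q, hqs, hqt⟩ : ∃ q ∈ s.1, q ∉ t.1 := by
    by_contra! hsub
    exact hst (Subtype.ext (Finset.eq_of_subset_of_card_le hsub (t.2.2.trans s.2.2.symm).le))
  have hzero := T.coord_eq_zero_of_mem_convexHull s ⟨q, hqs⟩ inter_subset_left
    (fun hq => hqt hq.2) (T.mem_convexHull_inter (interior_subset hs) (interior_subset ht))
  rw [interior_simplexBody] at hs
  exact (hs ⟨q, hqs⟩).ne' hzero

lemma iUnion_interior_simplexBody_ae_eq (hΩ : interior (closure Ω) = Ω) (T : Triangulation Ω) :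
    (⋃ s, interior (simplexBody (T.basis s)) : Set (Euc d)) =ᵐ[volume] Ω := by
  refine (LE.le.eventuallyLE (iUnion_subset (T.interior_simplexBody_subset hΩ))).antisymm ?_
  have hfrontier : ∀ᵐ x : Euc d, ∀ s, x ∉ frontier (simplexBody (T.basis s)) :=
    ae_all_iff.2 fun s => measure_eq_zero_iff_ae_notMem.1
      ((convex_simplexBody (T.basis s)).addHaar_frontier volume)
  filter_upwards [hfrontier] with x hx hxΩ
  have hxcl : x ∈ closure Ω := subset_closure hxΩ
  rw [T.closure_eq_iUnion] at hxcl
  obtain ⟨s, hs⟩ := mem_iUnion.1 hxcl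
  exact mem_iUnion.2 ⟨s, not_not.1 fun hint => hx s ⟨subset_closure hs, hint⟩⟩

lemma setIntegral_eq_sum (hΩ : interior (closure Ω) = Ω) (T : Triangulation Ω) {f : Euc d → ℝ}
    (hf : IntegrableOn f Ω) :
    ∫ x in Ω, f x = ∑ s, ∫ x in interior (simplexBody (T.basis s)), f x := by
  rw [← setIntegral_congr_set (T.iUnion_interior_simplexBody_ae_eq hΩ), integral_iUnion_fintype
    (fun s => isOpen_interior.measurableSet) (fun s t hst => disjoint_interior_simplexBody hst)
    (fun s => hf.mono_set (T.interior_simplexBody_subset hΩ s))]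

end Triangulation

end Elements

namespace Triangulation

variable {Ω : Set (Euc d)}

/-- The facets of the elements, encoded as pairs of an element and the vertex of it opposite to the
facet: a facet shared by two elements occurs twice, once for each side. -/
abbrev Facet (T : Triangulation Ω) : Type := Σ s : T.elements, s.1

namespace Facet

variable {T : Triangulation Ω} (φ : T.Facet) {v g : Euc d → ℝ}

/-- The set of points of a facet. -/
def carrier : Set (Euc d) := simplexFace (T.basis φ.1) φ.2

/-- The open element adjacent to a facet, on the side which the facet stands for. -/
def cell : Set (Euc d) := interior (simplexBody (T.basis φ.1))

/-- The unit normal to a facet pointing out of its adjacent element. -/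
def normal : Euc d := faceNormal (T.basis φ.1) φ.2

open Classical in
/-- The trace of a function on a facet, taken from the adjacent element; it is `0` for functions
without such a trace. -/
def trace (v : Euc d → ℝ) : Euc d → ℝ :=
  if h : ∃ g, HasTrace φ.cell φ.carrier v g then h.choose else 0

lemma isClosed_carrier : IsClosed φ.carrier := isClosed_simplexFace _ _

lemma measurableSet_carrier : MeasurableSet φ.carrier := φ.isClosed_carrier.measurableSet

lemma cell_subset (hΩ : interior (closure Ω) = Ω) : φ.cell ⊆ Ω :=
  T.interior_simplexBody_subset hΩ φ.1

variable [NeZero d]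

instance isFiniteMeasure_surf_carrier : IsFiniteMeasure ((surf d).restrict φ.carrier) :=
  isFiniteMeasure_surf_simplexFace (T.basis φ.1) φ.2

lemma hasTrace_trace (hΩ : interior (closure Ω) = Ω) (hv : MemH1 Ω v) :
    HasTrace φ.cell φ.carrier v (φ.trace v) := by
  have hex : ∃ g, HasTrace φ.cell φ.carrier v g :=
    exists_hasTrace_simplexFace (T.basis φ.1) φ.2 (hv.mono (φ.cell_subset hΩ))
  rw [trace, dif_pos hex]
  exact hex.choose_spec

lemma memLp_trace (hΩ : interior (closure Ω) = Ω) (hv : MemH1 Ω v) :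
    MemLp (φ.trace v) 2 ((surf d).restrict φ.carrier) :=
  (φ.hasTrace_trace hΩ hv).2.1

lemma trace_ae_eq_of_hasTrace (h : HasTrace φ.cell φ.carrier v g) :
    φ.trace v =ᵐ[(surf d).restrict φ.carrier] g := by
  have hex : ∃ g, HasTrace φ.cell φ.carrier v g := ⟨g, h⟩
  rw [trace, dif_pos hex]
  exact HasTrace.ae_unique hex.choose_spec h

lemma trace_ae_eq_of_contDiff {η : Euc d → ℝ} (hη : ContDiff ℝ ∞ η) :
    φ.trace η =ᵐ[(surf d).restrict φ.carrier] η :=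
  φ.trace_ae_eq_of_hasTrace (hasTrace_of_contDiff isOpen_interior
    (isBounded_interior_simplexBody _) hη
    (memLp_of_continuous_of_isBounded (isCompact_simplexFace _ _).isBounded hη.continuous))

lemma exists_normal_ne_zero : ∃ j, φ.normal j ≠ 0 := by
  by_contra! hzero
  have hnormal : φ.normal = 0 := by
    ext j
    exact hzero j
  have hnorm : ‖φ.normal‖ = 1 := norm_faceNormal _ _
  rw [hnormal, norm_zero] at hnorm
  exact zero_ne_one hnorm

end Facet

/-- The union of all facets. -/
def skeleton (T : Triangulation Ω) : Set (Euc d) := ⋃ φ : T.Facet, φ.carrier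

/-- A point which lies in the relative interior of every facet that contains it. Almost all points
of the skeleton have this property, and near such a point the triangulation consists of half-spaces
(`IsFacePoint.exists_opposite`). -/
def IsGenericPoint (T : Triangulation Ω) (x : Euc d) : Prop :=
  ∀ φ : T.Facet, x ∈ φ.carrier → IsFacePoint (T.basis φ.1) φ.2 x

/-- The sum of `F φ x` over the facets `φ` which contain `x`. -/
def facetSum {T : Triangulation Ω} (F : T.Facet → Euc d → ℝ) (x : Euc d) : ℝ :=
  ∑ φ : T.Facet, φ.carrier.indicator (F φ) x

variable {T : Triangulation Ω} {x : Euc d} {F : T.Facet → Euc d → ℝ}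

lemma isClosed_skeleton (T : Triangulation Ω) : IsClosed T.skeleton :=
  isClosed_iUnion_of_finite Facet.isClosed_carrier

lemma carrier_subset_skeleton (φ : T.Facet) : φ.carrier ⊆ T.skeleton :=
  subset_iUnion Facet.carrier φ

lemma skeleton_subset_closure (T : Triangulation Ω) : T.skeleton ⊆ closure Ω :=
  iUnion_subset fun φ _ hx => T.simplexBody_subset_closure φ.1 hx.1

lemma frontier_subset_skeleton (hΩ : interior (closure Ω) = Ω) (T : Triangulation Ω) :
    frontier Ω ⊆ T.skeleton := by
  intro x hx
  have hxcl := frontier_subset_closure hx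
  rw [T.closure_eq_iUnion] at hxcl
  obtain ⟨s, hs⟩ := mem_iUnion.1 hxcl
  have hint : x ∉ interior (simplexBody (T.basis s)) := fun hint =>
    notMem_of_mem_frontier hΩ hx (T.interior_simplexBody_subset hΩ s hint)
  rw [interior_simplexBody, mem_ofPred_eq] at hint
  push Not at hint
  obtain ⟨p, hp⟩ := hint
  exact mem_iUnion.2 ⟨(⟨s, p⟩ : T.Facet), hs, hp.antisymm (hs p)⟩

lemma ae_skeleton_of_ae_carrier {P : T.Facet → Euc d → Prop}
    (h : ∀ φ, ∀ᵐ x ∂(surf d).restrict φ.carrier, P φ x) :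
    ∀ᵐ x ∂(surf d), ∀ φ, x ∈ φ.carrier → P φ x :=
  ae_all_iff.2 fun φ => (ae_restrict_iff' φ.measurableSet_carrier).1 (h φ)

lemma Facet.integrable_indicator_carrier {φ : T.Facet} {f : Euc d → ℝ}
    (hf : IntegrableOn f φ.carrier (surf d)) :
    Integrable (φ.carrier.indicator f) ((surf d).restrict T.skeleton) := by
  rw [integrable_indicator_iff φ.measurableSet_carrier, IntegrableOn,
    Measure.restrict_restrict_of_subset (carrier_subset_skeleton φ)]
  exact hf

lemma integrableOn_facetSum (hF : ∀ φ : T.Facet, IntegrableOn (F φ) φ.carrier (surf d)) :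
    IntegrableOn (facetSum F) T.skeleton (surf d) :=
  integrable_finsetSum _ fun φ _ => Facet.integrable_indicator_carrier (hF φ)

lemma integral_facetSum (hF : ∀ φ : T.Facet, IntegrableOn (F φ) φ.carrier (surf d)) :
    ∫ x in T.skeleton, facetSum F x ∂(surf d) =
      ∑ φ : T.Facet, ∫ x in φ.carrier, F φ x ∂(surf d) := by
  simp only [facetSum]
  rw [integral_finsetSum _ fun φ _ => Facet.integrable_indicator_carrier (hF φ)]
  refine Finset.sum_congr rfl fun φ _ => ?_
  rw [integral_indicator φ.measurableSet_carrier,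
    Measure.restrict_restrict_of_subset (carrier_subset_skeleton φ)]

lemma Facet.eq_of_isFacePoint {φ ψ : T.Facet} (hφ : IsFacePoint (T.basis φ.1) φ.2 x)
    (hψ : IsFacePoint (T.basis ψ.1) ψ.2 x) (h : φ.1 = ψ.1) : φ = ψ := by
  obtain ⟨s, p⟩ := φ
  obtain ⟨t, q⟩ := ψ
  obtain rfl : s = t := h
  congr 1
  by_contra hne
  exact (hψ.2 p hne).ne' hφ.1

variable [NeZero d]

lemma ae_isGenericPoint (T : Triangulation Ω) : ∀ᵐ x ∂(surf d), T.IsGenericPoint x := by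
  refine ae_all_iff.2 fun φ => ?_
  have hother : ∀ᵐ x ∂(surf d), ∀ j, j ≠ φ.2 →
      x ∉ simplexFace (T.basis φ.1) φ.2 ∩ simplexFace (T.basis φ.1) j := by
    refine ae_all_iff.2 fun j => ?_
    by_cases hj : j = φ.2
    · exact .of_forall fun x hne => absurd hj hne
    · filter_upwards [measure_eq_zero_iff_ae_notMem.1
        (surf_simplexFace_inter_eq_zero (T.basis φ.1) (Ne.symm hj))] with x hx _ using hx
  filter_upwards [hother] with x hx hφ
  exact ⟨hφ.2, fun j hj => (hφ.1 j).lt_of_ne fun hzero => hx j hj ⟨hφ, hφ.1, hzero.symm⟩⟩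

lemma IsGenericPoint.exists_facetSum_eq_add (hx : T.IsGenericPoint x)
    (hΩ : interior (closure Ω) = Ω) (hxΩ : x ∈ Ω) {φ : T.Facet} (hφ : x ∈ φ.carrier) :
    ∃ ψ : T.Facet, ψ.normal = -φ.normal ∧ ∀ F, facetSum F x = F φ x + F ψ x := by
  have hp := hx φ hφ
  obtain ⟨t, ht, hts⟩ : ∃ t, x ∈ simplexBody (T.basis t) ∧ t ≠ φ.1 := by
    by_contra! huniq
    exact (hp.notMem_iff hΩ).2 huniq hxΩ
  obtain ⟨q, hq, c, hc, hcoord⟩ := hp.exists_opposite ht hts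
  have hne : (⟨t, q⟩ : T.Facet) ≠ φ := fun heq => hts (congrArg Sigma.fst heq)
  have hψ : x ∈ Facet.carrier (T := T) ⟨t, q⟩ := hq.mem_simplexFace
  refine ⟨⟨t, q⟩, faceNormal_eq_neg hc hcoord, fun F => ?_⟩
  rw [facetSum, Fintype.sum_eq_add φ ⟨t, q⟩ hne.symm, indicator_of_mem hφ, indicator_of_mem hψ]
  rintro χ ⟨hχφ, hχψ⟩
  refine indicator_of_notMem (fun hχ => ?_) _
  by_cases hs : χ.1 = φ.1
  · exact hχφ (Facet.eq_of_isFacePoint (hx χ hχ) hp hs)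
  · exact hχψ (Facet.eq_of_isFacePoint (hx χ hχ) hq (hp.eq_of_mem_simplexBody ht hts hχ.1 hs))

lemma IsGenericPoint.facetSum_eq (hx : T.IsGenericPoint x) (hΩ : interior (closure Ω) = Ω)
    (hxΩ : x ∉ Ω) {φ : T.Facet} (hφ : x ∈ φ.carrier) (F : T.Facet → Euc d → ℝ) :
    facetSum F x = F φ x := by
  rw [facetSum, Fintype.sum_eq_single φ, indicator_of_mem hφ]
  intro χ hne
  refine indicator_of_notMem (fun hχ => hne ?_) _
  exact Facet.eq_of_isFacePoint (hx χ hχ) (hx φ hφ) (((hx φ hφ).notMem_iff hΩ).1 hxΩ _ hχ.1)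

/-- The `k`-th component of the normal flux of `v w` out of the elements, summed over the sides of
the facets: the boundary term of elementwise integration by parts. -/
def flux (T : Triangulation Ω) (k : Fin d) (v w : Euc d → ℝ) : Euc d → ℝ :=
  facetSum fun φ : T.Facet => fun x => φ.normal k * (φ.trace v x * φ.trace w x)

/-- The `k`-th component of the normal jump of `v` across the facets. -/
def jump (T : Triangulation Ω) (k : Fin d) (v : Euc d → ℝ) : Euc d → ℝ :=
  facetSum fun φ : T.Facet => fun x => φ.normal k * φ.trace v x

variable {v w : Euc d → ℝ}

lemma Facet.integrableOn_normal_mul_trace_mul_trace (hΩ : interior (closure Ω) = Ω)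
    (hv : MemH1 Ω v) (hw : MemH1 Ω w) (k : Fin d) (φ : T.Facet) :
    IntegrableOn (fun x => φ.normal k * (φ.trace v x * φ.trace w x)) φ.carrier (surf d) :=
  ((φ.memLp_trace hΩ hv).integrable_mul (φ.memLp_trace hΩ hw)).const_mul _

lemma integrableOn_flux (hΩ : interior (closure Ω) = Ω) (T : Triangulation Ω) (hv : MemH1 Ω v)
    (hw : MemH1 Ω w) (k : Fin d) : IntegrableOn (T.flux k v w) T.skeleton (surf d) :=
  integrableOn_facetSum (Facet.integrableOn_normal_mul_trace_mul_trace hΩ hv hw k)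

lemma integrableOn_jump (hΩ : interior (closure Ω) = Ω) (T : Triangulation Ω) (hv : MemH1 Ω v)
    (k : Fin d) : IntegrableOn (T.jump k v) T.skeleton (surf d) :=
  integrableOn_facetSum fun φ =>
    ((φ.memLp_trace hΩ hv).integrable one_le_two).const_mul (φ.normal k)

lemma integral_add_integral_eq_integral_flux (hΩ : interior (closure Ω) = Ω)
    (T : Triangulation Ω) (hv : MemH1 Ω v) (hw : MemH1 Ω w) (k : Fin d) :
    (∫ x in Ω, v x * weakPartial Ω k w x) + (∫ x in Ω, w x * weakPartial Ω k v x) =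
      ∫ x in T.skeleton, T.flux k v w x ∂(surf d) := by
  have hsub := T.interior_simplexBody_subset hΩ
  have hcell : ∀ (s : T.elements) {a c : Euc d → ℝ}, MemH1 Ω c →
      ∫ x in interior (simplexBody (T.basis s)), a x * weakPartial Ω k c x =
        ∫ x in interior (simplexBody (T.basis s)),
          a x * weakPartial (interior (simplexBody (T.basis s))) k c x := by
    intro s a c hc
    refine integral_congr_ae ?_
    filter_upwards [weakPartial_mono_ae_eq isOpen_interior (hsub s) hc k] with x hx
    rw [hx]
  have hvw : IntegrableOn (fun x => v x * weakPartial Ω k w x) Ω :=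
    hv.1.integrable_mul (hw.memL2_weakPartial k)
  have hwv : IntegrableOn (fun x => w x * weakPartial Ω k v x) Ω :=
    hw.1.integrable_mul (hv.memL2_weakPartial k)
  simp only [flux]
  rw [integral_facetSum (Facet.integrableOn_normal_mul_trace_mul_trace hΩ hv hw k),
    Fintype.sum_sigma, T.setIntegral_eq_sum hΩ hvw, T.setIntegral_eq_sum hΩ hwv,
    ← Finset.sum_add_distrib]
  refine Finset.sum_congr rfl fun s _ => ?_
  rw [hcell s hw, hcell s hv, integral_simplexBody_by_parts (T.basis s)
    (hv.mono (hsub s)) (hw.mono (hsub s))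
    (fun p => Facet.hasTrace_trace ⟨s, p⟩ hΩ hv) (fun p => Facet.hasTrace_trace ⟨s, p⟩ hΩ hw)]
  refine Finset.sum_congr rfl fun p _ => ?_
  rw [integral_const_mul]
  rfl

lemma flux_ae_eq_mul_jump (T : Triangulation Ω) {η : Euc d → ℝ} (hη : ContDiff ℝ ∞ η)
    (k : Fin d) (v : Euc d → ℝ) :
    T.flux k v η =ᵐ[surf d] fun x => η x * T.jump k v x := by
  filter_upwards [ae_skeleton_of_ae_carrier (T := T) fun φ => φ.trace_ae_eq_of_contDiff hη]
    with x hx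
  rw [flux, jump, facetSum, facetSum, Finset.mul_sum]
  refine Finset.sum_congr rfl fun φ _ => ?_
  by_cases hφ : x ∈ φ.carrier
  · rw [indicator_of_mem hφ, indicator_of_mem hφ, hx φ hφ]
    ring
  · rw [indicator_of_notMem hφ, indicator_of_notMem hφ, mul_zero]

lemma integral_mul_jump_eq_zero (hΩ : interior (closure Ω) = Ω) (T : Triangulation Ω)
    (hv : MemH1 Ω v) (k : Fin d) {η : Euc d → ℝ} (hη : ContDiff ℝ ∞ η)
    (hcomp : HasCompactSupport η) (hsupp : tsupport η ⊆ Ω) :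
    ∫ x in T.skeleton, η x * T.jump k v x ∂(surf d) = 0 := by
  have hbdd := T.isBounded_domain
  have hpartial : ∫ x in Ω, v x * weakPartial Ω k η x = ∫ x in Ω, v x * partialDeriv k η x := by
    refine integral_congr_ae ?_
    filter_upwards [(isWeakPartial_partialDeriv hbdd hη k).weakPartial_ae_eq
      (hΩ ▸ isOpen_interior)] with x hx
    rw [hx]
  rw [← integral_congr_ae (ae_restrict_of_ae (T.flux_ae_eq_mul_jump hη k v)),
    ← T.integral_add_integral_eq_integral_flux hΩ hv (memH1_of_contDiff hbdd hη), hpartial,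
    (isWeakPartial_weakPartial hv k).2 η hη hcomp hsupp]
  simp_rw [mul_comm (η _)]
  exact neg_add_cancel _

lemma jump_ae_eq_zero (hΩ : interior (closure Ω) = Ω) (T : Triangulation Ω) (hv : MemH1 Ω v)
    (k : Fin d) : ∀ᵐ x ∂(surf d).restrict T.skeleton, x ∈ Ω → T.jump k v x = 0 :=
  IsOpen.ae_eq_zero_of_integral_contDiff_smul_eq_zero (hΩ ▸ isOpen_interior)
    ((T.integrableOn_jump hΩ hv k).locallyIntegrable.locallyIntegrableOn _)
    fun _ hη hcomp hsupp => T.integral_mul_jump_eq_zero hΩ hv k hη hcomp hsupp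

lemma flux_ae_eq_zero (hΩ : interior (closure Ω) = Ω) (T : Triangulation Ω) (hv : MemH1 Ω v)
    (hw : MemH1 Ω w) (k : Fin d) :
    ∀ᵐ x ∂(surf d).restrict T.skeleton, x ∈ Ω → T.flux k v w x = 0 := by
  filter_upwards [ae_all_iff.2 (T.jump_ae_eq_zero hΩ hv), ae_all_iff.2 (T.jump_ae_eq_zero hΩ hw),
    ae_restrict_of_ae T.ae_isGenericPoint, ae_restrict_mem T.isClosed_skeleton.measurableSet]
    with x hjv hjw hgen hxs hx
  obtain ⟨φ, hφ⟩ := mem_iUnion.1 hxs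
  obtain ⟨ψ, hnormal, hsum⟩ := hgen.exists_facetSum_eq_add hΩ hx hφ
  obtain ⟨j, hj⟩ := φ.exists_normal_ne_zero
  have htrace : ∀ {a : Euc d → ℝ}, T.jump j a x = 0 → φ.trace a x = ψ.trace a x := by
    intro a ha
    rw [jump, hsum, hnormal, PiLp.neg_apply, neg_mul, ← sub_eq_add_neg, ← mul_sub] at ha
    exact sub_eq_zero.1 ((mul_eq_zero.1 ha).resolve_left hj)
  rw [flux, hsum, hnormal, PiLp.neg_apply, htrace (hjv j hx), htrace (hjw j hx)]
  ring

end Triangulation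

namespace Triangulation

variable {Ω : Set (Euc d)} {T : Triangulation Ω} {u v w g g' : Euc d → ℝ}

lemma isBdryTrace_iff : IsBdryTrace T v g ↔
    ∀ φ : T.Facet, φ.carrier ⊆ frontier Ω → HasTrace φ.cell φ.carrier v g := by
  simp only [Facet.carrier, Facet.cell, simplexFace_basis, simplexBody_basis]
  exact ⟨fun h φ => h φ.1 φ.1.2 φ.2 φ.2.2, fun h s hs p hp => h ⟨⟨s, hs⟩, ⟨p, hp⟩⟩⟩

lemma isBdryTrace_of_hasTrace (hΩ : interior (closure Ω) = Ω) (T : Triangulation Ω)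
    (h : HasTrace Ω (frontier Ω) v g) : IsBdryTrace T v g :=
  isBdryTrace_iff.2 fun φ hφ => h.mono isOpen_interior (φ.cell_subset hΩ) hφ

lemma normalDeriv_mul_eq_sum (T : Triangulation Ω) (u w : Euc d → ℝ) (x : Euc d) :
    normalDeriv T u x * bdryTrace T w x = ∑ k, outerNormal Ω x k *
      (bdryTrace T (weakPartial Ω k u) x * bdryTrace T w x) := by
  rw [normalDeriv, Finset.sum_mul]
  exact Finset.sum_congr rfl fun k _ => by ring

variable [NeZero d]

lemma exists_isBdryTrace (hΩ : interior (closure Ω) = Ω) (T : Triangulation Ω)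
    (hv : MemH1 Ω v) : ∃ g, IsBdryTrace T v g := by
  refine ⟨facetSum fun φ : T.Facet => φ.trace v, isBdryTrace_iff.2 fun φ hφ =>
    (φ.hasTrace_trace hΩ hv).congr ?_⟩
  filter_upwards [ae_restrict_of_ae T.ae_isGenericPoint, ae_restrict_mem φ.measurableSet_carrier]
    with x hgen hx
  exact (hgen.facetSum_eq hΩ (notMem_of_mem_frontier hΩ (hφ hx)) hx fun φ => φ.trace v).symm

lemma isBdryTrace_bdryTrace (hΩ : interior (closure Ω) = Ω) (T : Triangulation Ω)
    (hv : MemH1 Ω v) : IsBdryTrace T v (bdryTrace T v) := by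
  have hex := T.exists_isBdryTrace hΩ hv
  rw [bdryTrace, dif_pos hex]
  exact hex.choose_spec

lemma ae_eq_trace_of_isBdryTrace (hΩ : interior (closure Ω) = Ω) (h : IsBdryTrace T v g) :
    ∀ᵐ x ∂(surf d).restrict (frontier Ω), ∀ φ : T.Facet, x ∈ φ.carrier → g x = φ.trace v x := by
  refine ae_all_iff.2 fun φ => ?_
  by_cases hφ : φ.carrier ⊆ frontier Ω
  · filter_upwards [ae_restrict_of_ae ((ae_restrict_iff' φ.measurableSet_carrier).1
      (φ.trace_ae_eq_of_hasTrace (isBdryTrace_iff.1 h φ hφ)))] with x hx hxφ using (hx hxφ).symm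
  · filter_upwards [ae_restrict_of_ae T.ae_isGenericPoint,
      ae_restrict_mem isClosed_frontier.measurableSet] with x hgen hx hxφ
    exact absurd ((hgen φ hxφ).simplexFace_subset_frontier hΩ (notMem_of_mem_frontier hΩ hx)) hφ

lemma ae_eq_of_isBdryTrace (hΩ : interior (closure Ω) = Ω) (h : IsBdryTrace T v g)
    (h' : IsBdryTrace T v g') : g =ᵐ[(surf d).restrict (frontier Ω)] g' := by
  filter_upwards [ae_eq_trace_of_isBdryTrace hΩ h, ae_eq_trace_of_isBdryTrace hΩ h',
    ae_restrict_mem isClosed_frontier.measurableSet] with x hg hg' hx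
  obtain ⟨φ, hφ⟩ := mem_iUnion.1 (T.frontier_subset_skeleton hΩ hx)
  rw [hg φ hφ, hg' φ hφ]

lemma bdryTrace_ae_eq_of_hasTrace (hΩ : interior (closure Ω) = Ω) (T : Triangulation Ω)
    (h : HasTrace Ω (frontier Ω) v g) : bdryTrace T v =ᵐ[(surf d).restrict (frontier Ω)] g :=
  ae_eq_of_isBdryTrace hΩ (T.isBdryTrace_bdryTrace hΩ h.1) (T.isBdryTrace_of_hasTrace hΩ h)

lemma flux_ae_eq (hΩ : interior (closure Ω) = Ω) (T : Triangulation Ω) (hv : MemH1 Ω v)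
    (hw : MemH1 Ω w) (k : Fin d) :
    T.flux k v w =ᵐ[(surf d).restrict (frontier Ω)]
      fun x => outerNormal Ω x k * (bdryTrace T v x * bdryTrace T w x) := by
  filter_upwards [ae_eq_trace_of_isBdryTrace hΩ (T.isBdryTrace_bdryTrace hΩ hv),
    ae_eq_trace_of_isBdryTrace hΩ (T.isBdryTrace_bdryTrace hΩ hw),
    ae_restrict_of_ae T.ae_isGenericPoint, ae_restrict_mem isClosed_frontier.measurableSet]
    with x htv htw hgen hx
  obtain ⟨φ, hφ⟩ := mem_iUnion.1 (T.frontier_subset_skeleton hΩ hx)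
  have hxΩ := notMem_of_mem_frontier hΩ hx
  have hp := hgen φ hφ
  rw [flux, hgen.facetSum_eq hΩ hxΩ hφ, htv φ hφ, htw φ hφ,
    (hp.isOuterNormal hΩ ((hp.notMem_iff hΩ).1 hxΩ)).outerNormal_eq]
  rfl

lemma integrableOn_outerNormal_mul (hΩ : interior (closure Ω) = Ω) (T : Triangulation Ω)
    (hv : MemH1 Ω v) (hw : MemH1 Ω w) (k : Fin d) :
    IntegrableOn (fun x => outerNormal Ω x k * (bdryTrace T v x * bdryTrace T w x))
      (frontier Ω) (surf d) :=
  ((T.integrableOn_flux hΩ hv hw k).mono_set (T.frontier_subset_skeleton hΩ)).congr_fun_ae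
    (T.flux_ae_eq hΩ hv hw k)

theorem integral_by_parts (hΩ : interior (closure Ω) = Ω) (T : Triangulation Ω)
    (hv : MemH1 Ω v) (hw : MemH1 Ω w) (k : Fin d) :
    (∫ x in Ω, v x * weakPartial Ω k w x) + (∫ x in Ω, w x * weakPartial Ω k v x) =
      ∫ x in frontier Ω, outerNormal Ω x k * (bdryTrace T v x * bdryTrace T w x) ∂(surf d) := by
  rw [T.integral_add_integral_eq_integral_flux hΩ hv hw k,
    ← integral_congr_ae (T.flux_ae_eq hΩ hv hw k)]
  refine setIntegral_eq_of_subset_of_ae_sdiff_eq_zero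
    T.isClosed_skeleton.measurableSet.nullMeasurableSet (T.frontier_subset_skeleton hΩ) ?_
  filter_upwards [(ae_restrict_iff' T.isClosed_skeleton.measurableSet).1
    (T.flux_ae_eq_zero hΩ hv hw k)] with x hx hxs
  refine hx hxs.1 (not_not.1 fun hxΩ => hxs.2 ⟨T.skeleton_subset_closure hxs.1, ?_⟩)
  exact fun hint => hxΩ (interior_subset hint)

lemma integrableOn_normalDeriv_mul (hΩ : interior (closure Ω) = Ω) (T : Triangulation Ω)
    (hu : MemH2 Ω u) (hw : MemH1 Ω w) :
    IntegrableOn (fun x => normalDeriv T u x * bdryTrace T w x) (frontier Ω) (surf d) := by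
  simp_rw [normalDeriv_mul_eq_sum]
  exact integrable_finsetSum _ fun k _ => T.integrableOn_outerNormal_mul hΩ (hu.2 k) hw k

theorem green_formula (hΩ : interior (closure Ω) = Ω) (T : Triangulation Ω) (hu : MemH2 Ω u)
    (hw : MemH1 Ω w) :
    innerGrad Ω u w + innerL2 Ω (laplacian Ω u) w =
      ∫ x in frontier Ω, normalDeriv T u x * bdryTrace T w x ∂(surf d) := by
  have hgrad : ∀ k, IntegrableOn (fun x => weakPartial Ω k u x * weakPartial Ω k w x) Ω :=
    fun k => (hu.1.memL2_weakPartial k).integrable_mul (hw.memL2_weakPartial k)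
  have hlap : ∀ k, IntegrableOn (fun x => weakPartial Ω k (weakPartial Ω k u) x * w x) Ω :=
    fun k => ((hu.2 k).memL2_weakPartial k).integrable_mul hw.1
  simp_rw [normalDeriv_mul_eq_sum, innerGrad, innerL2, laplacian, Finset.sum_mul]
  rw [integral_finsetSum _ fun k _ => T.integrableOn_outerNormal_mul hΩ (hu.2 k) hw k,
    integral_finsetSum _ fun k _ => hgrad k, integral_finsetSum _ fun k _ => hlap k,
    ← Finset.sum_add_distrib]
  refine Finset.sum_congr rfl fun k _ => ?_
  rw [← T.integral_by_parts hΩ (hu.2 k) hw k]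
  simp_rw [mul_comm (w _)]

lemma surf_skeleton_lt_top (T : Triangulation Ω) : surf d T.skeleton < ⊤ :=
  (measure_iUnion_le _).trans_lt <| by
    rw [tsum_fintype]
    exact ENNReal.sum_lt_top.2 fun φ _ => surf_simplexFace_lt_top (T.basis φ.1) φ.2

lemma hasTrace_frontier_of_contDiff (hΩ : interior (closure Ω) = Ω) (T : Triangulation Ω)
    {η : Euc d → ℝ} (hη : ContDiff ℝ ∞ η) : HasTrace Ω (frontier Ω) η η := by
  have hb := T.isBounded_domain
  have : IsFiniteMeasure ((surf d).restrict (frontier Ω)) := isFiniteMeasure_restrict.2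
    ((measure_mono (T.frontier_subset_skeleton hΩ)).trans_lt T.surf_skeleton_lt_top).ne
  exact hasTrace_of_contDiff (hΩ ▸ isOpen_interior) hb hη (memLp_of_continuous_of_isBounded
    (hb.closure.subset frontier_subset_closure) hη.continuous)

lemma bdryTrace_ae_eq_of_contDiff (hΩ : interior (closure Ω) = Ω) (T : Triangulation Ω)
    {η : Euc d → ℝ} (hη : ContDiff ℝ ∞ η) :
    bdryTrace T η =ᵐ[(surf d).restrict (frontier Ω)] η :=
  T.bdryTrace_ae_eq_of_hasTrace hΩ (T.hasTrace_frontier_of_contDiff hΩ hη)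

lemma integrableOn_normalDeriv (hΩ : interior (closure Ω) = Ω) (T : Triangulation Ω)
    (hu : MemH2 Ω u) : IntegrableOn (normalDeriv T u) (frontier Ω) (surf d) := by
  have hone : ContDiff ℝ ∞ fun _ : Euc d => (1 : ℝ) := contDiff_const
  refine Integrable.congr (T.integrableOn_normalDeriv_mul hΩ hu
    (memH1_of_contDiff T.isBounded_domain hone)) ?_
  filter_upwards [T.bdryTrace_ae_eq_of_contDiff hΩ hone] with x hx
  rw [hx, mul_one]

end Triangulation

/-! ### Consistency -/

section Consistency

variable {Ω ΓV ΓW : Set (Euc d)} {κ : ℝ} {f u w η : Euc d → ℝ}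

/-- A splitting of `∂Ω` into two disjoint portions which are closed up to null sets of the surface
measure and whose closures cover `∂Ω`; unlike in `IsBoundarySplitting` they may be disconnected. -/
structure IsBoundaryPartition (Ω ΓV ΓW : Set (Euc d)) : Prop where
  subset_V : ΓV ⊆ frontier Ω
  subset_W : ΓW ⊆ frontier Ω
  disjoint : Disjoint ΓV ΓW
  cover : closure ΓV ∪ closure ΓW = frontier Ω
  null_V : surf d (closure ΓV \ ΓV) = 0
  null_W : surf d (closure ΓW \ ΓW) = 0

lemma closure_diff_subset_inter_closure_frontier_diff {Γ : Set (Euc d)} (hΓ : Γ ⊆ frontier Ω) :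
    closure Γ \ Γ ⊆ closure Γ ∩ closure (frontier Ω \ Γ) :=
  fun _ hx => ⟨hx.1, subset_closure ⟨closure_minimal hΓ isClosed_frontier hx.1, hx.2⟩⟩

lemma IsBoundarySplitting.isBoundaryPartition (h : IsBoundarySplitting Ω ΓV ΓW) :
    IsBoundaryPartition Ω ΓV ΓW where
  subset_V := h.subset_V
  subset_W := h.subset_W
  disjoint := h.disjoint
  cover := h.cover
  null_V := measure_mono_null (closure_diff_subset_inter_closure_frontier_diff h.subset_V) h.null_V
  null_W := measure_mono_null (closure_diff_subset_inter_closure_frontier_diff h.subset_W) h.null_W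

namespace IsBoundaryPartition

lemma symm (h : IsBoundaryPartition Ω ΓV ΓW) : IsBoundaryPartition Ω ΓW ΓV :=
  ⟨h.subset_W, h.subset_V, h.disjoint.symm, union_comm (closure ΓV) _ ▸ h.cover, h.null_W,
    h.null_V⟩

lemma ae_mem_of_mem_closure (h : IsBoundaryPartition Ω ΓV ΓW) :
    ∀ᵐ x ∂(surf d), x ∈ closure ΓV → x ∈ ΓV := by
  filter_upwards [measure_eq_zero_iff_ae_notMem.1 h.null_V] with x hx hxcl
  exact not_not.1 fun hxV => hx ⟨hxcl, hxV⟩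

lemma nullMeasurableSet (h : IsBoundaryPartition Ω ΓV ΓW) : NullMeasurableSet ΓV (surf d) := by
  refine (isClosed_closure (s := ΓV)).measurableSet.nullMeasurableSet.congr ?_
  filter_upwards [h.ae_mem_of_mem_closure] with x hx
  exact propext ⟨hx, fun hxV => subset_closure hxV⟩

lemma ae_mem_of_mem_diff (h : IsBoundaryPartition Ω ΓV ΓW) :
    ∀ᵐ x ∂(surf d), x ∈ frontier Ω \ ΓW → x ∈ ΓV := by
  filter_upwards [h.ae_mem_of_mem_closure, h.symm.ae_mem_of_mem_closure] with x hV hW hx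
  rw [← h.cover] at hx
  exact hx.1.elim hV fun hxcl => absurd (hW hxcl) hx.2

lemma ae_notMem_closure (h : IsBoundaryPartition Ω ΓV ΓW) :
    ∀ᵐ x ∂(surf d), x ∈ ΓV → x ∉ closure ΓW := by
  filter_upwards [h.symm.ae_mem_of_mem_closure] with x hW hx hxcl
  exact Set.disjoint_left.1 h.disjoint hx (hW hxcl)

end IsBoundaryPartition

lemma MemH2.memL2_laplacian (hu : MemH2 Ω u) : MemL2 Ω (laplacian Ω u) :=
  memLp_finsetSum _ fun k _ => (hu.2 k).memL2_weakPartial k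

lemma MemH2.memL2_opL (hu : MemH2 Ω u) : MemL2 Ω (opL Ω κ u) :=
  hu.memL2_laplacian.neg.add (hu.1.1.const_mul κ)

lemma innerL2_opL (hu : MemH2 Ω u) (hw : MemL2 Ω w) :
    innerL2 Ω (opL Ω κ u) w = κ * innerL2 Ω u w - innerL2 Ω (laplacian Ω u) w := by
  have hlap : Integrable (fun x => laplacian Ω u x * w x) (volume.restrict Ω) :=
    hu.memL2_laplacian.integrable_mul hw
  have huw : Integrable (fun x => κ * (u x * w x)) (volume.restrict Ω) :=
    (MemLp.integrable_mul (p := 2) (q := 2) hu.1.1 hw).const_mul κ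
  simp_rw [innerL2]
  rw [← integral_const_mul, ← integral_sub huw hlap]
  simp only [opL, neg_add_eq_sub, sub_mul, mul_assoc]

lemma innerL2_comm (v w : Euc d → ℝ) : innerL2 Ω v w = innerL2 Ω w v := by
  simp only [innerL2, mul_comm]

lemma innerGrad_comm (v w : Euc d → ℝ) : innerGrad Ω v w = innerGrad Ω w v := by
  simp only [innerGrad, mul_comm]

lemma formAh_comm (T : Triangulation Ω) (v w : Euc d → ℝ) :
    formAh T ΓV ΓW κ v w = formAh T ΓW ΓV κ w v := by
  rw [formAh, formAh, innerGrad_comm, innerL2_comm]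
  ring

lemma IsWeakAdjoint.isWeakPrimal (h : IsWeakAdjoint Ω ΓV ΓW κ f u) :
    IsWeakPrimal Ω ΓW ΓV κ f u :=
  ⟨h.1, fun w hw => by rw [← h.2 w hw, formA, formA, innerGrad_comm, innerL2_comm]⟩

variable [NeZero d]

lemma formA_eq_innerL2_opL_add (hΩ : interior (closure Ω) = Ω) (T : Triangulation Ω)
    (hu : MemH2 Ω u) (hw : MemH1 Ω w) :
    formA Ω κ u w = innerL2 Ω (opL Ω κ u) w +
      ∫ x in frontier Ω, normalDeriv T u x * bdryTrace T w x ∂(surf d) := by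
  rw [← T.green_formula hΩ hu hw, innerL2_opL hu hw.1, formA]
  ring

lemma MemH1Zero.bdryTrace_ae_eq_zero (hΩ : interior (closure Ω) = Ω) (T : Triangulation Ω)
    (hΓ : ΓV ⊆ frontier Ω) (hu : MemH1Zero Ω ΓV u) :
    ∀ᵐ x ∂(surf d).restrict ΓV, bdryTrace T u x = 0 := by
  obtain ⟨-, g, hg, hgzero⟩ := hu
  filter_upwards [ae_restrict_of_ae_restrict_of_subset hΓ (T.bdryTrace_ae_eq_of_hasTrace hΩ hg),
    hgzero] with x hx hgx
  rw [hx, hgx]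

lemma memH1Zero_of_contDiff (hΩ : interior (closure Ω) = Ω) (T : Triangulation Ω) {Γ : Set (Euc d)}
    (hΓ : NullMeasurableSet Γ (surf d)) (hη : ContDiff ℝ ∞ η) (hzero : ∀ x ∈ Γ, η x = 0) :
    MemH1Zero Ω Γ η :=
  ⟨memH1_of_contDiff T.isBounded_domain hη, η, T.hasTrace_frontier_of_contDiff hΩ hη,
    (ae_restrict_iff'₀ hΓ).2 (.of_forall hzero)⟩

/-- Half of the boundary term of Green's formula is the Nitsche term on `ΓW`; the rest vanishes with
the Cauchy data of `u` on `ΓV`. -/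
theorem formAh_eq_of_normalDeriv_ae_eq_zero (hΩ : interior (closure Ω) = Ω)
    (hΓ : IsBoundaryPartition Ω ΓV ΓW) (T : Triangulation Ω) (hu : MemH2 Ω u)
    (huV : MemH1Zero Ω ΓV u) (hnV : ∀ᵐ x ∂(surf d).restrict ΓV, normalDeriv T u x = 0)
    (hw : MemH1 Ω w) : formAh T ΓV ΓW κ u w = innerL2 Ω (opL Ω κ u) w := by
  have hintV : ∫ x in ΓV, normalDeriv T w x * bdryTrace T u x ∂(surf d) = 0 := by
    refine integral_eq_zero_of_ae ?_
    filter_upwards [huV.bdryTrace_ae_eq_zero hΩ T hΓ.subset_V] with x hx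
    rw [hx, mul_zero, Pi.zero_apply]
  have hintW : ∫ x in frontier Ω, normalDeriv T u x * bdryTrace T w x ∂(surf d) =
      ∫ x in ΓW, normalDeriv T u x * bdryTrace T w x ∂(surf d) := by
    refine setIntegral_eq_of_subset_of_ae_sdiff_eq_zero
      isClosed_frontier.measurableSet.nullMeasurableSet hΓ.subset_W ?_
    filter_upwards [hΓ.ae_mem_of_mem_diff, (ae_restrict_iff'₀ hΓ.nullMeasurableSet).1 hnV]
      with x hxV hx hxW
    rw [hx (hxV hxW), zero_mul]
  have hgreen := formA_eq_innerL2_opL_add (κ := κ) hΩ T hu hw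
  rw [formA, hintW] at hgreen
  rw [formAh, hintV, hgreen]
  ring

namespace IsWeakPrimal

lemma innerL2_eq (hΩ : interior (closure Ω) = Ω) (hΓ : IsBoundaryPartition Ω ΓV ΓW)
    (T : Triangulation Ω) (hu : MemH2 Ω u) (h : IsWeakPrimal Ω ΓV ΓW κ f u)
    (hη : ContDiff ℝ ∞ η) (hzero : ∀ x ∈ ΓW, η x = 0) :
    innerL2 Ω f η = innerL2 Ω (opL Ω κ u) η +
      ∫ x in frontier Ω, normalDeriv T u x * η x ∂(surf d) := by
  have hηW := memH1Zero_of_contDiff hΩ T hΓ.symm.nullMeasurableSet hη hzero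
  rw [← h.2 η hηW, formA_eq_innerL2_opL_add hΩ T hu hηW.1]
  congr 1
  refine integral_congr_ae ?_
  filter_upwards [T.bdryTrace_ae_eq_of_contDiff hΩ hη] with x hx
  rw [hx]

lemma opL_ae_eq (hΩ : interior (closure Ω) = Ω) (hΓ : IsBoundaryPartition Ω ΓV ΓW)
    (T : Triangulation Ω) (hf : LocallyIntegrableOn f Ω) (hu : MemH2 Ω u)
    (h : IsWeakPrimal Ω ΓV ΓW κ f u) : opL Ω κ u =ᵐ[volume.restrict Ω] f := by
  have hΩo : IsOpen Ω := hΩ ▸ isOpen_interior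
  refine ae_eq_of_setIntegral_mul_eq hΩo hu.memL2_opL.locallyIntegrableOn hf
    fun η hη _ hsupp => ?_
  have hzero : ∀ x ∈ frontier Ω, η x = 0 := fun x hx =>
    image_eq_zero_of_notMem_tsupport fun hxη => notMem_of_mem_frontier hΩ hx (hsupp hxη)
  have hweak := h.innerL2_eq hΩ hΓ T hu hη fun x hx => hzero x (hΓ.subset_W hx)
  rw [setIntegral_eq_zero_of_forall_eq_zero fun x hx => by rw [hzero x hx, mul_zero],
    add_zero] at hweak
  exact hweak.symm

/-- Green's formula turns the weak formulation into orthogonality of `∇u·n` to all smooth functions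
supported away from the closure of `ΓW`. -/
theorem normalDeriv_ae_eq_zero (hΩ : interior (closure Ω) = Ω)
    (hΓ : IsBoundaryPartition Ω ΓV ΓW) (T : Triangulation Ω) (hf : LocallyIntegrableOn f Ω)
    (hu : MemH2 Ω u) (h : IsWeakPrimal Ω ΓV ΓW κ f u) :
    ∀ᵐ x ∂(surf d).restrict ΓV, normalDeriv T u x = 0 := by
  have horth : ∀ η : Euc d → ℝ, ContDiff ℝ ∞ η → tsupport η ⊆ (closure ΓW)ᶜ →
      ∫ x in frontier Ω, η x • normalDeriv T u x ∂(surf d) = 0 := by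
    intro η hη hsupp
    have hweak := h.innerL2_eq hΩ hΓ T hu hη fun x hx =>
      image_eq_zero_of_notMem_tsupport fun hxη => hsupp hxη (subset_closure hx)
    have hinner : innerL2 Ω (opL Ω κ u) η = innerL2 Ω f η :=
      integral_congr_ae ((h.opL_ae_eq hΩ hΓ T hf hu).mul (ae_eq_refl η))
    rw [hinner, left_eq_add] at hweak
    simpa only [smul_eq_mul, mul_comm] using hweak
  have hzero := (isClosed_closure (s := ΓW)).isOpen_compl
    |>.ae_eq_zero_of_integral_contDiff_smul_eq_zero
      ((T.integrableOn_normalDeriv hΩ hu).locallyIntegrable.locallyIntegrableOn _)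
      fun η hη _ hsupp => horth η hη hsupp
  rw [ae_restrict_iff'₀ hΓ.nullMeasurableSet]
  filter_upwards [(ae_restrict_iff' isClosed_frontier.measurableSet).1 hzero, hΓ.ae_notMem_closure]
    with x hx hxcl hxV
  exact hx (hΓ.subset_V hxV) (hxcl hxV)

end IsWeakPrimal

theorem primal_consistency (hΩ : interior (closure Ω) = Ω) (hΓ : IsBoundaryPartition Ω ΓV ΓW)
    (T : Triangulation Ω) (hu : MemH2 Ω u)
    (h : (LocallyIntegrableOn f Ω ∧ IsWeakPrimal Ω ΓV ΓW κ f u) ∨ IsStrongPrimal T ΓV κ f u)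
    (hw : MemH1 Ω w) : formAh T ΓV ΓW κ u w = innerL2 Ω (opL Ω κ u) w := by
  rcases h with ⟨hf, hweak⟩ | hstrong
  · exact formAh_eq_of_normalDeriv_ae_eq_zero hΩ hΓ T hu hweak.1
      (hweak.normalDeriv_ae_eq_zero hΩ hΓ T hf hu) hw
  · exact formAh_eq_of_normalDeriv_ae_eq_zero hΩ hΓ T hu hstrong.1 hstrong.2.2 hw

end Consistency

end CauchyFEM

end

open CauchyFEM in
theorem mainTheorem8_general {d : ℕ} [NeZero d] {Ω : Set (Euc d)}
    (hΩ : interior (closure Ω) = Ω) {ΓV ΓW : Set (Euc d)} (hΓ : IsBoundaryPartition Ω ΓV ΓW)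
    (T : Triangulation Ω) (κ : ℝ) :
    (∀ f u : Euc d → ℝ, MemH2 Ω u →
      (LocallyIntegrableOn f Ω ∧ IsWeakPrimal Ω ΓV ΓW κ f u ∨ IsStrongPrimal T ΓV κ f u) →
      ∀ φ : Euc d → ℝ, MemH1 Ω φ → formAh T ΓV ΓW κ u φ = innerL2 Ω (opL Ω κ u) φ) ∧
    (∀ g z : Euc d → ℝ, MemH2 Ω z →
      (LocallyIntegrableOn g Ω ∧ IsWeakAdjoint Ω ΓV ΓW κ g z ∨ IsStrongAdjoint T ΓW κ g z) →
      ∀ φ : Euc d → ℝ, MemH1 Ω φ → formAh T ΓV ΓW κ φ z = innerL2 Ω φ (opLAdj Ω κ z)) := by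
  refine ⟨fun f u hu h φ hφ => primal_consistency hΩ hΓ T hu h hφ, fun g z hz h φ hφ => ?_⟩
  rw [formAh_comm, innerL2_comm]
  exact primal_consistency hΩ hΓ.symm T hz (h.imp_left (And.imp_right (·.isWeakPrimal))) hφ

theorem mainTheorem8 {d : ℕ} (hd : d = 2 ∨ d = 3)
    (Ω : Set (CauchyFEM.Euc d)) (hΩ : CauchyFEM.IsPolyhedralDomain Ω)
    (ΓV ΓW : Set (CauchyFEM.Euc d)) (hΓ : CauchyFEM.IsBoundarySplitting Ω ΓV ΓW)
    (T : CauchyFEM.Triangulation Ω) (k : ℕ) (κ : ℝ) :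
    -- consistency for the primal problem, with test functions `w + wh ∈ W + W_h`
    (∀ f u : CauchyFEM.Euc d → ℝ, CauchyFEM.MemL2 Ω f → CauchyFEM.MemH2 Ω u →
      (CauchyFEM.IsWeakPrimal Ω ΓV ΓW κ f u ∨ CauchyFEM.IsStrongPrimal T ΓV κ f u) →
      ∀ w wh : CauchyFEM.Euc d → ℝ, CauchyFEM.MemH1Zero Ω ΓW w → CauchyFEM.MemFE T k wh →
        CauchyFEM.formAh T ΓV ΓW κ u (w + wh) =
          CauchyFEM.innerL2 Ω (CauchyFEM.opL Ω κ u) (w + wh)) ∧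
    -- consistency for the adjoint problem, with test functions `v + vh ∈ V + V_h`
    (∀ g z : CauchyFEM.Euc d → ℝ, CauchyFEM.MemL2 Ω g → CauchyFEM.MemH2 Ω z →
      (CauchyFEM.IsWeakAdjoint Ω ΓV ΓW κ g z ∨ CauchyFEM.IsStrongAdjoint T ΓW κ g z) →
      ∀ v vh : CauchyFEM.Euc d → ℝ, CauchyFEM.MemH1Zero Ω ΓV v → CauchyFEM.MemFE T k vh →
        CauchyFEM.formAh T ΓV ΓW κ (v + vh) z =
          CauchyFEM.innerL2 Ω (v + vh) (CauchyFEM.opLAdj Ω κ z)) := by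
  have : NeZero d := ⟨by omega⟩
  obtain ⟨hprimal, hadjoint⟩ := mainTheorem8_general hΩ.2.2.1 hΓ.isBoundaryPartition T κ
  exact ⟨fun f u hf hu h w wh hw hwh => hprimal f u hu
      (h.imp_left fun hweak => ⟨hf.locallyIntegrableOn, hweak⟩) (w + wh) (hw.1.add hwh.1),
    fun g z hg hz h v vh hv hvh => hadjoint g z hz
      (h.imp_left fun hweak => ⟨hg.locallyIntegrableOn, hweak⟩) (v + vh) (hv.1.add hvh.1)⟩
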